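/- **Conventions.** A linear order is scattered if the rationals do not embed into it. For a nonempty scattered linear order $\mathfrak L=(L,\le)$ let $\sim_0$ be equality, let $x\sim_{\alpha+1}y$ iff the closed interval between the classes of $x$ and $y$ in $\mathfrak L/{\sim_\alpha}$ is finite, and for limit $\beta$ let $x\sim_\beta y$ iff $x\sim_\alpha y$ for some $\alpha<\beta$. $\mathsf{FC}(\mathfrak L)$ is the least $\alpha$ such that $\mathfrak L/{\sim_\alpha}$ has exactly one element, and $\mathsf{FC}_*(\mathfrak L)$ the least $\alpha$ such that $\mathfrak L/{\sim_\alpha}$ is finite (so $\mathsf{FC}_*\le\mathsf{FC}\le\mathsf{FC}_*+1$). An $\mathfrak L$-word is a map from $L$ to a finite alphabet with a blank symbol $\diamond$; it is finite if only finitely many of its letters are not $\diamond$; the convolution of words is $(w\otimes v)(l)=(w(l),v(l))$. An $\mathfrak L$-automaton has a finite state set $Q$, initial and final states, and transitions in $(Q\times\Sigma\times Q)\cup(2^Q\times Q)\cup(Q\times 2^Q)$. A run on $w$ is a map $r$ from the cuts of $\mathfrak L$ to $Q$ such that $(r(c),w(l),r(d))$ is a transition whenever $c,d$ are the consecutive cuts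 around $l$; $(\lim_{c^-}r,r(c))$ is a transition for every cut $c\neq(\emptyset,L)$ without direct predecessor; and $(r(c),\lim_{c^+}r)$ is a transition for every cut $c\neq(L,\emptyset)$ without direct successor, where $\lim_{c^-}r$ (resp. $\lim_{c^+}r$) is the set of states occurring on cuts arbitrarily close to $c$ from below (resp. above). A word is accepted if it has a run that is initial at $(\emptyset,L)$ and final at $(L,\emptyset)$. An ordinal $\beta$ is *finite word $\mathfrak L$-oracle-automatic* if there are an $\mathfrak L$-word $o$ (the oracle) and $\mathfrak L$-automata $\mathcal A,\mathcal B$ such that $(\beta,\le)$ is isomorphic to the structure whose domain is $\{w: \mathcal A\text{ accepts }w\otimes o\}$, which consists of finite words only, and whose relation is $\{(w_1,w_2):\mathcal B\text{ accepts }w_1\otimes w_2\otimes o\}$. **Corollary.** Let $\mathfrak L$ be a nonempty scattered linear order with $\mathsf{FC}(\mathfrak L)<\omega$. Then the finite word $\mathfrak L$-oracle-automatic ordinals are exactly the ordinals below $\omega^{\omega^{\mathsf{FC}_*(\mathfrak L)}}$. In particular, for every $n<\omega$, if $\mathsf{FC}(\mathfrak L)=\mathsf{FC}_*(\mathfrak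 L)=1+n$, then $\omega^{\omega^n}$ is finite word $\mathfrak L$-oracle-automatic, and the finite word $\mathfrak L$-oracle-automatic ordinals are exactly the ordinals below $\omega^{\omega^{n+1}}$. -/

import Mathlib

open Ordinal

universe u

/-! ### Scattered linear orders and finite condensation ranks -/

/-- A linear order is scattered if the rationals do not embed into it. -/
def IsScattered (L : Type u) [LinearOrder L] : Prop :=
  IsEmpty (ℚ ↪o L)

/-- The successor step of the iterated finite condensation: `x` and `y` are identified if the
closed interval between the classes of `x` and `y` contains only finitely many classes of `r`.
As the classes of `r` are intervals, the classes in that closed interval are exactly the classes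
of the points between `x` and `y` (in whichever order these two come). -/
def condStep {L : Type u} [LinearOrder L] (r : L → L → Prop) (x y : L) : Prop :=
  ((fun z => {w | r z w}) '' Set.uIcc x y).Finite

/-- The `α`-th condensation relation `x ∼_α y`. -/
noncomputable def condRel (L : Type u) [LinearOrder L] (α : Ordinal.{u}) : L → L → Prop :=
  Ordinal.limitRecOn (motive := fun _ => L → L → Prop) α
    (fun x y => x = y)
    (fun _ r => condStep r)
    (fun β _ r x y => ∃ γ, ∃ h : γ < β, r γ h x y)

theorem condRel_zero {L : Type u} [LinearOrder L] (x y : L) :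
    condRel L 0 x y ↔ x = y := by
  simp [condRel]

theorem condRel_succ {L : Type u} [LinearOrder L] (α : Ordinal.{u}) (x y : L) :
    condRel L (α + 1) x y ↔
      ((fun z => {w | condRel L α z w}) '' Set.uIcc x y).Finite := by
  unfold condRel
  rw [Ordinal.limitRecOn_add_one]
  rfl

theorem condRel_limit {L : Type u} [LinearOrder L] {β : Ordinal.{u}}
    (hβ : Order.IsSuccLimit β) (x y : L) :
    condRel L β x y ↔ ∃ γ < β, condRel L γ x y := by
  unfold condRel
  rw [Ordinal.limitRecOn_limit _ _ _ _ hβ]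
  simp

theorem condRel_facts {L : Type u} [LinearOrder L] (β : Ordinal.{u}) :
    Equivalence (condRel L β) ∧
    (∀ x y, condRel L β x y → ∀ z ∈ Set.uIcc x y, condRel L β x z) ∧
    (∀ α ≤ β, ∀ x y, condRel L α x y → condRel L β x y) := by
  induction β using Ordinal.limitRecOn with
  | zero =>
    refine ⟨⟨fun x => ?_, fun {x y} h => ?_, fun {x y z} h h' => ?_⟩, fun x y h z hz => ?_,
      fun α hα x y h => ?_⟩
    · simp [condRel_zero]
    · simp only [condRel_zero] at *; exact h.symm
    · simp only [condRel_zero] at *; exact h.trans h'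
    · simp only [condRel_zero] at *; subst h; simpa [eq_comm] using hz
    · have : α = 0 := by simpa using hα
      subst this; exact h
  | add_one β ih =>
    obtain ⟨he, hc, hm⟩ := ih
    refine ⟨⟨fun x => ?_, fun {x y} h => ?_, fun {x y z} h h' => ?_⟩, fun x y h z hz => ?_,
      fun α hα x y h => ?_⟩
    · simp [condRel_succ]
    · rw [condRel_succ, Set.uIcc_comm]; rwa [condRel_succ] at h
    · rw [condRel_succ] at *
      refine (h.union h').subset ?_
      rw [← Set.image_union]
      exact Set.image_mono Set.uIcc_subset_uIcc_union_uIcc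
    · rw [condRel_succ] at *
      exact h.subset (Set.image_mono (Set.uIcc_subset_uIcc Set.left_mem_uIcc hz))
    · rcases hα.lt_or_eq with hlt | rfl
      · have h1 := hm α (Order.lt_add_one_iff.mp hlt) x y h
        rw [condRel_succ]
        refine (Set.finite_singleton {w | condRel L β x w}).subset ?_
        rintro _ ⟨z, hz, rfl⟩
        have h2 := hc x y h1 z hz
        ext w
        exact ⟨fun h => he.trans h2 h, fun h => he.trans (he.symm h2) h⟩
      · exact h
  | limit β hβ ih =>
    refine ⟨⟨fun x => ?_, fun {x y} h => ?_, fun {x y z} h h' => ?_⟩, fun x y h z hz => ?_,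
      fun α hα x y h => ?_⟩
    · rw [condRel_limit hβ]
      exact ⟨0, hβ.bot_lt, by simp [condRel_zero]⟩
    · rw [condRel_limit hβ] at *
      obtain ⟨γ, hγ, h⟩ := h
      exact ⟨γ, hγ, (ih γ hγ).1.symm h⟩
    · rw [condRel_limit hβ] at *
      obtain ⟨γ, hγ, h⟩ := h
      obtain ⟨δ, hδ, h'⟩ := h'
      have hmx : max γ δ < β := max_lt hγ hδ
      obtain ⟨he, -, hm⟩ := ih _ hmx
      exact ⟨_, hmx, he.trans (hm _ (le_max_left _ _) _ _ h) (hm _ (le_max_right _ _) _ _ h')⟩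
    · rw [condRel_limit hβ] at *
      obtain ⟨γ, hγ, h⟩ := h
      exact ⟨γ, hγ, (ih γ hγ).2.1 x y h z hz⟩
    · rcases hα.lt_or_eq with hlt | rfl
      · rw [condRel_limit hβ]; exact ⟨α, hlt, h⟩
      · exact h

/-- The `α`-th condensation as an equivalence relation on `L`. -/
noncomputable def condSetoid (L : Type u) [LinearOrder L] (α : Ordinal.{u}) : Setoid L :=
  ⟨condRel L α, (condRel_facts α).1⟩

/-- The finite condensation rank: the least `α` such that `L/∼_α` has exactly one element. -/
noncomputable def FC (L : Type u) [LinearOrder L] : Ordinal.{u} :=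
  sInf {α | Nat.card (Quotient (condSetoid L α)) = 1}

/-- The rank `FC_*`: the least `α` such that `L/∼_α` is finite. -/
noncomputable def FCStar (L : Type u) [LinearOrder L] : Ordinal.{u} :=
  sInf {α | Finite (Quotient (condSetoid L α))}

/-- For a nonempty scattered order the infimum that defines `FC` (hence also the one that defines
`FCStar`) is taken over a nonempty set of ordinals, so both are genuine minima. -/
theorem exists_condensation_of_isScattered (L : Type u) [LinearOrder L] [Nonempty L]
    (h : IsScattered L) : ∃ α : Ordinal.{u}, Nat.card (Quotient (condSetoid L α)) = 1 := by
  obtain ⟨α, β, hαβ, hne⟩ : ∃ α β : Ordinal.{u}, condRel L α = condRel L β ∧ α ≠ β := by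
    by_contra! hcon
    exact not_injective_of_ordinal (condRel L) (fun a b hab => hcon a b hab)
  wlog hlt : α < β generalizing α β
  · exact this β α hαβ.symm hne.symm (lt_of_le_of_ne (not_lt.mp hlt) hne.symm)
  have hs : ∀ x y, condRel L (α + 1) x y → condRel L α x y := fun x y hxy => by
    rw [hαβ]; exact (condRel_facts β).2.2 _ (Order.add_one_le_of_lt hlt) x y hxy
  obtain ⟨he, hc, -⟩ := condRel_facts (L := L) α
  refine ⟨α, ?_⟩
  by_contra hcon
  have hxy : ∃ x y : L, x < y ∧ ¬ condRel L α x y := by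
    by_contra! hall
    obtain ⟨x⟩ := ‹Nonempty L›
    refine hcon (Nat.card_eq_one_iff_exists.mpr ⟨Quotient.mk (condSetoid L α) x, fun c => ?_⟩)
    induction c using Quotient.inductionOn with
    | h y =>
      refine Quotient.sound ?_
      change condRel L α y x
      rcases lt_trichotomy x y with h1 | rfl | h1
      · exact he.symm (hall _ _ h1)
      · exact he.refl _
      · exact hall _ _ h1
  -- a set of representatives of the classes, which is densely ordered
  let ρ : L → L := fun x => (Quotient.mk (condSetoid L α) x).out
  have hρ : ∀ x, condRel L α (ρ x) x := fun x =>
    Quotient.exact (Quotient.out_eq (Quotient.mk (condSetoid L α) x))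
  have hρe : ∀ x y, condRel L α x y → ρ x = ρ y := fun x y hxy => by
    have : Quotient.mk (condSetoid L α) x = Quotient.mk (condSetoid L α) y := Quotient.sound hxy
    simp only [ρ, this]
  let S : Set L := Set.range ρ
  have hS : ∀ x y : S, condRel L α x y → x = y := by
    rintro ⟨_, x, rfl⟩ ⟨_, y, rfl⟩ hxy
    exact Subtype.ext (hρe _ _ (he.trans (he.symm (hρ x)) (he.trans hxy (hρ y))))
  have hbet : ∀ x y : S, x < y → ∃ z : S, x < z ∧ z < y := by
    intro x y hlt'
    by_contra! hno
    refine hlt'.ne (hS x y (hs _ _ ?_))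
    rw [condRel_succ]
    refine ((Set.finite_singleton {w | condRel L α y w}).insert {w | condRel L α x w}).subset ?_
    rintro _ ⟨z, hz, rfl⟩
    rw [Set.uIcc_of_le (show (x : L) ≤ y from hlt'.le)] at hz
    have hcls : ∀ a b : L, condRel L α a b → {w | condRel L α a w} = {w | condRel L α b w} := by
      intro a b hab
      ext w
      exact ⟨fun h => he.trans (he.symm hab) h, fun h => he.trans hab h⟩
    let r : S := ⟨ρ z, z, rfl⟩
    rcases le_or_gt r x with h1 | h1
    · left
      refine hcls _ _ (he.trans (he.symm (hρ z)) ?_)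
      exact hc _ _ (hρ z) _ (Set.mem_uIcc.mpr (Or.inl ⟨h1, hz.1⟩))
    · right
      refine hcls _ _ (he.trans (he.symm (hρ z)) ?_)
      exact hc _ _ (hρ z) _ (Set.mem_uIcc.mpr (Or.inr ⟨hz.2, hno r h1⟩))
  have : DenselyOrdered S := ⟨hbet⟩
  obtain ⟨x, y, hlt', hnr⟩ := hxy
  have : Nontrivial S := ⟨⟨ρ x, x, rfl⟩, ⟨ρ y, y, rfl⟩, fun hEq => hnr
    (he.trans (he.symm (hρ x)) (by rw [Subtype.mk.inj hEq]; exact hρ y))⟩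
  obtain ⟨f⟩ := Order.embedding_from_countable_to_dense (α := ℚ) (β := S)
  exact h.false (f.trans (OrderEmbedding.subtype _))

/-! ### Automata on words indexed by a linear order -/

/-- A cut of `L`, given by its downward closed lower part and ordered by inclusion. The least cut
`(∅, L)` is `⊥`, the greatest cut `(L, ∅)` is `⊤`; the consecutive cuts around `l` are
`LowerSet.Iio l` and `LowerSet.Iic l`. -/
abbrev Cut (L : Type u) [LinearOrder L] : Type u := LowerSet L

/-- The values that `r` takes on cuts arbitrarily close to `c` from below. -/
def limBelow {L : Type u} [LinearOrder L] {Q : Type} (r : Cut L → Q) (c : Cut L) : Set Q :=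
  {q | ∀ d < c, ∃ e, d ≤ e ∧ e < c ∧ r e = q}

/-- The values that `r` takes on cuts arbitrarily close to `c` from above. -/
def limAbove {L : Type u} [LinearOrder L] {Q : Type} (r : Cut L → Q) (c : Cut L) : Set Q :=
  {q | ∀ d, c < d → ∃ e, c < e ∧ e ≤ d ∧ r e = q}

/-- A finite automaton with limit transitions (Bruyère and Carton) over the alphabet `A`. -/
structure LimitAutomaton (A : Type) where
  /-- the states -/
  Q : Type
  finite_Q : Finite Q
  /-- the initial states -/
  init : Set Q
  /-- the final states -/
  final : Set Q
  /-- the successor transitions -/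
  succTrans : Set (Q × A × Q)
  /-- the transitions in `2^Q × Q`, from the limit set below a cut to the state at the cut -/
  rightLimTrans : Set (Set Q × Q)
  /-- the transitions in `Q × 2^Q`, from the state at a cut to the limit set above the cut -/
  leftLimTrans : Set (Q × Set Q)

/-- `r` is a run of `M` on the word `w`. -/
structure LimitAutomaton.IsRun {L : Type u} [LinearOrder L] {A : Type} (M : LimitAutomaton A)
    (w : L → A) (r : Cut L → M.Q) : Prop where
  succ : ∀ l : L, (r (LowerSet.Iio l), w l, r (LowerSet.Iic l)) ∈ M.succTrans
  right : ∀ c : Cut L, c ≠ ⊥ → (¬ ∃ d, d ⋖ c) → (limBelow r c, r c) ∈ M.rightLimTrans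
  left : ∀ c : Cut L, c ≠ ⊤ → (¬ ∃ d, c ⋖ d) → (r c, limAbove r c) ∈ M.leftLimTrans

/-- `M` accepts the word `w`, that is, `w` lies in the language of `M`. -/
def LimitAutomaton.Accepts {L : Type u} [LinearOrder L] {A : Type} (M : LimitAutomaton A)
    (w : L → A) : Prop :=
  ∃ r : Cut L → M.Q, M.IsRun w r ∧ r ⊥ ∈ M.init ∧ r ⊤ ∈ M.final

/-- The convolution of two words. -/
def conv {L : Type u} {A B : Type} (w : L → A) (v : L → B) : L → A × B :=
  fun l => (w l, v l)

/-- A word over an alphabet `Option Γ`, whose blank symbol is `none`, is finite if its support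
is finite. -/
def IsFiniteWord {L : Type u} {Γ : Type} (w : L → Option Γ) : Prop :=
  {l | w l ≠ none}.Finite

/-- The structure `(V, E)` with one binary relation is (isomorphic to) a finite word `L`-oracle
automatic structure: for some finite alphabets, some oracle `o` and some automata `M`, `N`, the
map `e` is an isomorphism from `(V, E)` onto the structure whose domain consists of the words `w`
such that `M` accepts `w ⊗ o`, all of which are finite words, and whose relation consists of the
pairs `(w₁, w₂)` such that `N` accepts `w₁ ⊗ w₂ ⊗ o`. -/
def IsFiniteWordOracleAutomatic (L : Type u) [LinearOrder L] {V : Type u}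
    (E : V → V → Prop) : Prop :=
  ∃ (Γ Ω : Type) (_ : Finite Γ) (_ : Finite Ω) (o : L → Option Ω)
    (M : LimitAutomaton (Option Γ × Option Ω))
    (N : LimitAutomaton (Option Γ × Option Γ × Option Ω))
    (e : V → L → Option Γ),
    Function.Injective e ∧
    Set.range e = {w | M.Accepts (conv w o)} ∧
    (∀ w, M.Accepts (conv w o) → IsFiniteWord w) ∧
    {p : (L → Option Γ) × (L → Option Γ) | N.Accepts (conv p.1 (conv p.2 o))} =
      {p | ∃ x y, E x y ∧ p = (e x, e y)}

/-- The ordinal `β`, as a linear order, is finite word `L`-oracle-automatic. -/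
def IsFiniteWordOracleAutomaticOrdinal (L : Type u) [LinearOrder L] (β : Ordinal.{u}) : Prop :=
  IsFiniteWordOracleAutomatic L (fun x y : β.ToType => x ≤ y)

/-! ### Hessenberg sums -/

/-! Upper bound. Fix a word outside a set `S` of positions. If `S` is an interval inside one class
of `∼_m`, the elements whose words agree with it off `S` have order type below `ω ^ (ω ^ m)`; this
is proved by induction on `m`. An automaton sees a pair of words on an interval `I` only through the
pairs of states joined by runs across `I`, so there are finitely many types of pairs. Hence any set
of elements splits into finitely many pieces on which `x ≤ y` follows once the parts inside `I` and
the parts outside `I` compare that way (`IsWordPresentation.exists_product`). Natural sums measure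
such pieces: a union has type at most the Hessenberg sum (`otype_union_le`), and an order extending
a product with coordinates below `ω ^ a` and `ω ^ b` has type at most `ω ^ hsum a b`
(`otype_le_of_product`). As `ω ^ m` is closed under `hsum`, adjoining an interval preserves the
bound `ω ^ (ω ^ m)` (`FibreBound.union`). Finiteness of the words drives the step to `m + 1`
(`FibreBound.of_tails`): finitely many words are all blank on some tail of a class, and comparing
with them there shows that tails cannot create new powers beyond `ω ^ (ω ^ m * k)`.

Lower bound. If `L/∼_j` is infinite for all `j < m`, then `L` contains a comb of height `m`, a
nesting of monotone or antitone sequences (`hasComb_of_infinite`). Its points are enumerated in type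
`ω ^ m`, and a ranking of `L` lets an automaton read off that enumeration: the parity of the
greatest rank between two points says whether it runs with or against `L` (`exists_isRankedComb`).
With `k` tracks, finite words supported on the comb code the finite subsets of `ω ^ m * k`. Their
colexicographic order has type at least `2 ^ (ω ^ m * k)`, and these powers are cofinal in `ω ^ (ω ^
m)`. The oracle holds the comb, the ranking and a word `t`; the words below `t` represent the given
ordinal. All automata needed have runs that are constant near limits. -/

/-- The Hessenberg (natural) sum of two ordinals. -/
noncomputable def hsum (a b : Ordinal.{u}) : Ordinal.{u} :=
  max (⨆ x : Set.Iio a, Order.succ (hsum x.1 b)) (⨆ x : Set.Iio b, Order.succ (hsum a x.1))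
termination_by (a, b)
decreasing_by all_goals cases x; decreasing_tactic

theorem hsum_le_iff {a b c : Ordinal.{u}} :
    hsum a b ≤ c ↔ (∀ a' < a, hsum a' b < c) ∧ ∀ b' < b, hsum a b' < c := by
  rw [hsum, max_le_iff, Ordinal.iSup_le_iff, Ordinal.iSup_le_iff]
  simp

theorem hsum_lt_hsum_right {a' a : Ordinal.{u}} (h : a' < a) (b : Ordinal.{u}) :
    hsum a' b < hsum a b :=
  (hsum_le_iff.1 le_rfl).1 _ h

theorem hsum_lt_hsum_left {b' b : Ordinal.{u}} (h : b' < b) (a : Ordinal.{u}) :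
    hsum a b' < hsum a b :=
  (hsum_le_iff.1 le_rfl).2 _ h

theorem hsum_le_hsum {a a' b b' : Ordinal.{u}} (ha : a ≤ a') (hb : b ≤ b') :
    hsum a b ≤ hsum a' b' := by
  refine le_trans (b := hsum a' b) ?_ ?_
  · rcases ha.eq_or_lt with rfl | h
    · exact le_rfl
    · exact (hsum_lt_hsum_right h b).le
  · rcases hb.eq_or_lt with rfl | h
    · exact le_rfl
    · exact (hsum_lt_hsum_left h a').le

/-- Well-founded induction on both arguments: decreasing one of them lowers either its coefficient
of `ω ^ d` or, with the coefficient kept, its remainder. Both cases lower the right-hand side. -/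
theorem hsum_mul_add_le {d : Ordinal.{u}}
    (hd : ∀ a < ω ^ d, ∀ b < ω ^ d, hsum a b < ω ^ d) :
    ∀ (x y : Ordinal.{u}) (i j : ℕ) (a b : Ordinal.{u}), a < ω ^ d → b < ω ^ d →
      x = ω ^ d * i + a → y = ω ^ d * j + b →
      hsum x y ≤ ω ^ d * ((i + j : ℕ) : Ordinal.{u}) + hsum a b := by
  have hpos : (0 : Ordinal.{u}) < ω ^ d := opow_pos d omega0_pos
  have hsplit : ∀ (z : Ordinal.{u}) (i : ℕ) (a : Ordinal.{u}), a < ω ^ d → z < ω ^ d * i + a →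
      ∃ (i' : ℕ) (a' : Ordinal.{u}), a' < ω ^ d ∧ z = ω ^ d * i' + a' ∧
        (i' < i ∨ i' = i ∧ a' < a) := by
    intro z i a ha hz
    have h1 : z < ω ^ d * ((i + 1 : ℕ) : Ordinal.{u}) := by
      refine hz.trans ?_
      rw [Nat.cast_add_one, mul_add, mul_one]
      exact (add_lt_add_iff_left _).2 ha
    have h2 : z / ω ^ d < ((i + 1 : ℕ) : Ordinal.{u}) := (Ordinal.lt_mul_iff_div_lt hpos.ne').1 h1
    obtain ⟨i', hi'⟩ := lt_omega0.1 (h2.trans (natCast_lt_omega0 _))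
    have h3 : ω ^ d * (i' : Ordinal.{u}) + z % ω ^ d = z := by
      rw [← hi']; exact Ordinal.div_add_mod _ _
    refine ⟨i', z % ω ^ d, Ordinal.mod_lt _ hpos.ne', h3.symm, ?_⟩
    rw [hi'] at h2
    have h4 : i' < i + 1 := by exact_mod_cast h2
    rcases (Nat.lt_succ_iff.1 h4).lt_or_eq with h | h
    · exact Or.inl h
    · subst h
      rw [← h3] at hz
      exact Or.inr ⟨rfl, (add_lt_add_iff_left _).1 hz⟩
  have hstep : ∀ (n n' : ℕ) (c : Ordinal.{u}), n < n' → c < ω ^ d →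
      ω ^ d * (n : Ordinal.{u}) + c < ω ^ d * n' := by
    intro n n' c hn hc
    have : ω ^ d * (n : Ordinal.{u}) + c < ω ^ d * ((n + 1 : ℕ) : Ordinal.{u}) := by
      rw [Nat.cast_add_one, mul_add, mul_one]
      exact (add_lt_add_iff_left _).2 hc
    refine this.trans_le ?_
    gcongr
    exact_mod_cast hn
  intro x
  induction x using WellFoundedLT.induction with | _ x ihx
  intro y
  induction y using WellFoundedLT.induction with | _ y ihy
  intro i j a b ha hb hx hy
  rw [hsum_le_iff]
  constructor
  · intro x' hx'
    obtain ⟨i', a', ha', hxe, hlt⟩ := hsplit x' i a ha (hx ▸ hx')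
    refine (ihx x' hx' y i' j a' b ha' hb hxe hy).trans_lt ?_
    rcases hlt with h | ⟨rfl, h⟩
    -- The coefficient has dropped, so closure of `ω ^ d` under `hsum` lets one spare copy of `ω ^
    -- d` absorb the remainders.
    · exact (hstep _ (i + j) _ (by omega) (hd _ ha' _ hb)).trans_le (le_self_add)
    · exact (add_lt_add_iff_left _).2 (hsum_lt_hsum_right h b)
  · intro y' hy'
    obtain ⟨j', b', hb', hye, hlt⟩ := hsplit y' j b hb (hy ▸ hy')
    refine (ihy y' hy' i j' a b' ha hb' hx hye).trans_lt ?_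
    rcases hlt with h | ⟨rfl, h⟩
    · exact (hstep _ (i + j) _ (by omega) (hd _ ha _ hb')).trans_le (le_self_add)
    · exact (add_lt_add_iff_left _).2 (hsum_lt_hsum_left h a)

theorem hsum_zero_zero : hsum (0 : Ordinal.{u}) 0 = 0 := by
  refine le_antisymm (hsum_le_iff.2 ⟨?_, ?_⟩) (zero_le) <;> intro a ha <;>
    exact absurd ha (not_lt_zero)

theorem lt_omega0_opow_mul_nat {d a : Ordinal.{u}} {n : ℕ} (h : a < ω ^ d * n) :
    ∃ (i : ℕ) (a' : Ordinal.{u}), i < n ∧ a' < ω ^ d ∧ a = ω ^ d * i + a' := by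
  have hpos : (0 : Ordinal.{u}) < ω ^ d := opow_pos d omega0_pos
  have h2 : a / ω ^ d < n := (Ordinal.lt_mul_iff_div_lt hpos.ne').1 h
  obtain ⟨i, hi⟩ := lt_omega0.1 (h2.trans (natCast_lt_omega0 _))
  refine ⟨i, a % ω ^ d, ?_, Ordinal.mod_lt _ hpos.ne', ?_⟩
  · rw [hi] at h2; exact_mod_cast h2
  · rw [← hi]; exact (Ordinal.div_add_mod _ _).symm

/-- Bounds with coefficients `n + 1` and `k + 1` mean leading coefficients at most `n` and `k`.
These add up to at most `n + k`, and the remainders need one further copy. -/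
theorem hsum_lt_mul_add {d : Ordinal.{u}}
    (hd : ∀ a < ω ^ d, ∀ b < ω ^ d, hsum a b < ω ^ d) {a b : Ordinal.{u}} {n k : ℕ}
    (ha : a < ω ^ d * (n + 1 : ℕ)) (hb : b < ω ^ d * (k + 1 : ℕ)) :
    hsum a b < ω ^ d * ((n + k + 1 : ℕ) : Ordinal.{u}) := by
  obtain ⟨i, a', hi, ha', rfl⟩ := lt_omega0_opow_mul_nat ha
  obtain ⟨j, b', hj, hb', rfl⟩ := lt_omega0_opow_mul_nat hb
  refine (hsum_mul_add_le hd _ _ i j a' b' ha' hb' rfl rfl).trans_lt ?_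
  refine ((add_lt_add_iff_left _).2 (hd _ ha' _ hb')).trans_le ?_
  rw [show ω ^ d * ((i + j : ℕ) : Ordinal.{u}) + ω ^ d = ω ^ d * ((i + j + 1 : ℕ) : Ordinal.{u}) by
    rw [Nat.cast_add_one, mul_add, mul_one]]
  gcongr <;> omega

/-- Powers of `ω` are closed under the Hessenberg sum. -/
theorem hsum_lt_omega0_opow (d : Ordinal.{u}) :
    ∀ a < ω ^ d, ∀ b < ω ^ d, hsum a b < ω ^ d := by
  induction d using WellFoundedLT.induction with | _ d ih
  intro a ha b hb
  rcases eq_or_ne d 0 with rfl | hd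
  · rw [opow_zero] at *
    rw [Order.lt_one_iff] at ha hb
    rw [ha, hb, hsum_zero_zero]
    exact zero_lt_one
  obtain ⟨c, hc, n, hn⟩ := (lt_omega0_opow hd).1 ha
  obtain ⟨c', hc', n', hn'⟩ := (lt_omega0_opow hd).1 hb
  -- Brings both bounds to the common exponent `max c c'`; the extra `1` gives the coefficients the
  -- successor form used above.
  have key : ∀ (x e f : Ordinal.{u}) (k : ℕ), e ≤ f → x < ω ^ e * k → x < ω ^ f * (k + 1 : ℕ) := by
    intro x e f k hef hx
    refine hx.trans_le ?_
    have := opow_le_opow_right omega0_pos hef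
    gcongr
    omega
  refine (hsum_lt_mul_add (ih (max c c') (max_lt hc hc')) (key _ _ _ _ (le_max_left _ _) hn)
    (key _ _ _ _ (le_max_right _ _) hn')).trans ?_
  exact opow_mul_lt_opow (natCast_lt_omega0 _) (max_lt hc hc')

theorem hsum_lt_omega0_opow_mul {d a b : Ordinal.{u}} {k : ℕ} (ha : a < ω ^ d * k)
    (hb : b < ω ^ d) : hsum a b < ω ^ d * k := by
  obtain ⟨k, rfl⟩ : ∃ k', k = k' + 1 := by
    refine Nat.exists_eq_succ_of_ne_zero ?_
    rintro rfl
    simp at ha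
  have := hsum_lt_mul_add (hsum_lt_omega0_opow d) ha (k := 0) (b := b) (by simpa using hb)
  simpa using this

/-! ### Order types of subsets of a well-order -/

/-- The order type of a subset of a well-order. -/
noncomputable def otype {V : Type u} [LinearOrder V] [WellFoundedLT V] (X : Set V) : Ordinal.{u} :=
  typeLT X

section otype

variable {V : Type u} [LinearOrder V] [WellFoundedLT V] {X Y : Set V}

theorem otype_mono (h : X ⊆ Y) : otype X ≤ otype Y := type_mono h

theorem typein_eq_otype (x : X) :
    typein (fun a b : X => a < b) x = otype (X ∩ Set.Iio (x : V)) := by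
  rw [← type_subrel, otype]
  refine Ordinal.type_eq.2 ⟨⟨⟨fun y => ⟨y.1.1, y.1.2, y.2⟩, fun y => ⟨⟨y.1, y.2.1⟩, y.2.2⟩,
    fun _ => rfl, fun _ => rfl⟩, Iff.rfl⟩⟩

theorem otype_inter_Iio_lt {x : V} (hx : x ∈ X) : otype (X ∩ Set.Iio x) < otype X := by
  rw [← typein_eq_otype ⟨x, hx⟩]
  exact typein_lt_type _ _

theorem exists_otype_inter_Iio_eq {o : Ordinal.{u}} (h : o < otype X) :
    ∃ x ∈ X, otype (X ∩ Set.Iio x) = o := by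
  obtain ⟨x, hx⟩ := typein_surj (fun a b : X => a < b) h
  exact ⟨x, x.2, by rw [← typein_eq_otype, hx]⟩

theorem otype_le_of_forall {o : Ordinal.{u}} (h : ∀ x ∈ X, otype (X ∩ Set.Iio x) < o) :
    otype X ≤ o := by
  by_contra! hlt
  obtain ⟨x, hx, he⟩ := exists_otype_inter_Iio_eq hlt
  exact (h x hx).ne he

/-- Below a point `x` of the union, the side containing `x` has strictly lost order type and the
other side has not grown; `hsum` is strictly monotone in each argument. -/
theorem otype_union_le : otype (X ∪ Y) ≤ hsum (otype X) (otype Y) := by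
  have key : ∀ z : V, otype ((X ∪ Y) ∩ Set.Iio z) ≤
      hsum (otype (X ∩ Set.Iio z)) (otype (Y ∩ Set.Iio z)) := by
    intro z
    induction z using WellFoundedLT.induction with | _ z ih
    refine otype_le_of_forall fun x hx => ?_
    have hmin : ∀ Z : Set V, (Z ∩ Set.Iio z) ∩ Set.Iio x = Z ∩ Set.Iio x := by
      intro Z
      rw [Set.inter_assoc, Set.Iio_inter_Iio, min_eq_right (le_of_lt hx.2)]
    rw [hmin]
    refine (ih x hx.2).trans_lt ?_
    rw [← hmin X, ← hmin Y]
    rcases hx.1 with h | h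
    · exact (hsum_lt_hsum_right (otype_inter_Iio_lt (Set.mem_inter h hx.2)) _).trans_le
        (hsum_le_hsum le_rfl (otype_mono Set.inter_subset_left))
    · exact (hsum_lt_hsum_left (otype_inter_Iio_lt (Set.mem_inter h hx.2)) _).trans_le
        (hsum_le_hsum (otype_mono Set.inter_subset_left) le_rfl)
  refine otype_le_of_forall fun x hx => (key x).trans_lt ?_
  rcases hx with h | h
  · exact (hsum_lt_hsum_right (otype_inter_Iio_lt h) _).trans_le
      (hsum_le_hsum le_rfl (otype_mono Set.inter_subset_left))
  · exact (hsum_lt_hsum_left (otype_inter_Iio_lt h) _).trans_le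
      (hsum_le_hsum (otype_mono Set.inter_subset_left) le_rfl)

theorem otype_empty : otype (∅ : Set V) = 0 := by
  rw [otype, type_eq_zero_iff_isEmpty]; infer_instance

theorem otype_iUnion_lt {ι : Type*} [Finite ι] {Z : ι → Set V} {c : Ordinal.{u}}
    (h : ∀ i, otype (Z i) < ω ^ c) : otype (⋃ i, Z i) < ω ^ c := by
  classical
  have key : ∀ s : Finset ι, otype (⋃ i ∈ s, Z i) < ω ^ c := by
    intro s
    induction s using Finset.induction_on with
    | empty => simpa [otype_empty] using opow_pos c omega0_pos
    | insert a s ha ih =>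
      rw [Finset.set_biUnion_insert]
      exact otype_union_le.trans_lt (hsum_lt_omega0_opow c _ (h a) _ ih)
  cases nonempty_fintype ι
  simpa using key Finset.univ

theorem otype_le_of_subset_iUnion {ι : Type*} [Finite ι] {Z : ι → Set V} {c : Ordinal.{u}}
    (h : ∀ i, otype (Z i) < ω ^ c) (hX : X ⊆ ⋃ i, Z i) : otype X < ω ^ c :=
  (otype_mono hX).trans_lt (otype_iUnion_lt h)

/-- A position below `o < ω ^ c` falls into one of finitely many blocks of length `ω ^ d` with `d <
c`. The difference is the position inside the block, which is what induction on the exponent needs.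
-/
theorem exists_blocks {c o : Ordinal.{u}} (ho : o < ω ^ c) (h0 : o ≠ 0) :
    ∃ d < c, ∃ n : ℕ, ∀ p < o,
      ∃ i : Fin n, ω ^ d * (i : ℕ) ≤ p ∧ p - ω ^ d * (i : ℕ) < ω ^ d := by
  have hc : c ≠ 0 := by
    rintro rfl
    rw [opow_zero, Order.lt_one_iff] at ho
    exact h0 ho
  obtain ⟨d, hd, n, hn⟩ := (lt_omega0_opow hc).1 ho
  refine ⟨d, hd, n, fun p hp => ?_⟩
  obtain ⟨i, p', hi, hp', rfl⟩ := lt_omega0_opow_mul_nat (hp.trans hn)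
  exact ⟨⟨i, hi⟩, le_self_add, by simpa using hp'⟩

theorem le_of_tsub_le_tsub_of_le {p q r : Ordinal.{u}} (hp : r ≤ p) (hq : r ≤ q)
    (h : p - r ≤ q - r) : p ≤ q := by
  rw [← Ordinal.add_sub_cancel_of_le hp, ← Ordinal.add_sub_cancel_of_le hq]
  gcongr

/-- A subset of a well-order whose order extends a product of two well-orders below `ω ^ a` and
`ω ^ b`. -/
theorem otype_le_of_product (a b : Ordinal.{u}) : ∀ (X : Set V) (f g : V → Ordinal.{u}),
    (∀ x ∈ X, f x < ω ^ a) → (∀ x ∈ X, g x < ω ^ b) →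
    (∀ x ∈ X, ∀ y ∈ X, f x ≤ f y → g x ≤ g y → x ≤ y) → otype X ≤ ω ^ hsum a b := by
  induction a using WellFoundedLT.induction generalizing b with | _ a iha
  induction b using WellFoundedLT.induction with | _ b ihb
  intro X f g hf hg hfg
  refine otype_le_of_forall fun x hx => ?_
  -- An element below `x` must be smaller in one coordinate, since otherwise the hypothesis would
  -- place `x` below it. Each half is then cut into blocks, which lowers the exponent of that
  -- coordinate.
  have hsub : X ∩ Set.Iio x ⊆ {y | y ∈ X ∧ f y < f x} ∪ {y | y ∈ X ∧ g y < g x} := by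
    rintro y ⟨hy, hyx⟩
    by_contra hcon
    simp only [Set.mem_union, Set.mem_ofPred_eq, hy, true_and, not_or, not_lt] at hcon
    exact absurd (hfg x hx y hy hcon.1 hcon.2) (not_le.2 hyx)
  refine (otype_mono hsub).trans_lt (otype_union_le.trans_lt (hsum_lt_omega0_opow _ _ ?_ _ ?_))
  · rcases eq_or_ne (f x) 0 with h0 | h0
    · have : {y | y ∈ X ∧ f y < f x} = ∅ := by ext y; simp [h0]
      rw [this, otype_empty]; exact opow_pos _ omega0_pos
    obtain ⟨d, hd, n, hn⟩ := exists_blocks (hf x hx) h0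
    refine otype_le_of_subset_iUnion (ι := Fin n)
      (Z := fun i => {y | y ∈ X ∧ ω ^ d * (i : ℕ) ≤ f y ∧ f y - ω ^ d * (i : ℕ) < ω ^ d})
      (fun i => ?_) ?_
    · refine (iha d hd b _ (fun y => f y - ω ^ d * (i : ℕ)) g (fun y hy => hy.2.2)
        (fun y hy => hg y hy.1) ?_).trans_lt ?_
      · intro y hy z hz h1 h2
        exact hfg y hy.1 z hz.1 (le_of_tsub_le_tsub_of_le hy.2.1 hz.2.1 h1) h2
      · exact (opow_lt_opow_iff_right one_lt_omega0).2 (hsum_lt_hsum_right hd b)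
    · rintro y ⟨hy, hlt⟩
      obtain ⟨i, hi⟩ := hn _ hlt
      exact Set.mem_iUnion.2 ⟨i, hy, hi⟩
  · rcases eq_or_ne (g x) 0 with h0 | h0
    · have : {y | y ∈ X ∧ g y < g x} = ∅ := by ext y; simp [h0]
      rw [this, otype_empty]; exact opow_pos _ omega0_pos
    obtain ⟨d, hd, n, hn⟩ := exists_blocks (hg x hx) h0
    refine otype_le_of_subset_iUnion (ι := Fin n)
      (Z := fun i => {y | y ∈ X ∧ ω ^ d * (i : ℕ) ≤ g y ∧ g y - ω ^ d * (i : ℕ) < ω ^ d})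
      (fun i => ?_) ?_
    · refine (ihb d hd _ f (fun y => g y - ω ^ d * (i : ℕ)) (fun y hy => hf y hy.1)
        (fun y hy => hy.2.2) ?_).trans_lt ?_
      · intro y hy z hz h1 h2
        exact hfg y hy.1 z hz.1 h1 (le_of_tsub_le_tsub_of_le hy.2.1 hz.2.1 h2)
      · exact (opow_lt_opow_iff_right one_lt_omega0).2 (hsum_lt_hsum_left hd a)
    · rintro y ⟨hy, hlt⟩
      obtain ⟨i, hi⟩ := hn _ hlt
      exact Set.mem_iUnion.2 ⟨i, hy, hi⟩

theorem le_of_otype_inter_Iio_le {y z : V} (hz : z ∈ X)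
    (h : otype (X ∩ Set.Iio y) ≤ otype (X ∩ Set.Iio z)) : y ≤ z := by
  by_contra! hlt
  refine absurd h (not_le.2 ?_)
  have := otype_inter_Iio_lt (X := X ∩ Set.Iio y) (Set.mem_inter hz hlt)
  rwa [Set.inter_assoc, Set.Iio_inter_Iio, min_eq_right (le_of_lt hlt)] at this

/-- Replaces `f` and `g` by positions in their images and cuts both into blocks, with exponents `a <
c` and `b < d`. Each of the finitely many cells has type at most `ω ^ hsum a b`, below `ω ^ c` by
`hcd`. -/
theorem otype_lt_of_product {c d : Ordinal.{u}} (hcd : ∀ a < c, ∀ b < d, hsum a b < c)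
    {f g : V → V} (hf : otype (f '' X) < ω ^ c) (hg : otype (g '' X) < ω ^ d)
    (hfg : ∀ x ∈ X, ∀ y ∈ X, f x ≤ f y → g x ≤ g y → x ≤ y) : otype X < ω ^ c := by
  rcases X.eq_empty_or_nonempty with rfl | ⟨x₀, hx₀⟩
  · rw [otype_empty]; exact opow_pos _ omega0_pos
  let F : V → Ordinal.{u} := fun x => otype (f '' X ∩ Set.Iio (f x))
  let G : V → Ordinal.{u} := fun x => otype (g '' X ∩ Set.Iio (g x))
  have hF : ∀ x ∈ X, F x < otype (f '' X) := fun x hx =>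
    otype_inter_Iio_lt (Set.mem_image_of_mem f hx)
  have hG : ∀ x ∈ X, G x < otype (g '' X) := fun x hx =>
    otype_inter_Iio_lt (Set.mem_image_of_mem g hx)
  obtain ⟨a, ha, n, hn⟩ := exists_blocks hf (not_lt_zero.elim <| · ▸ hF x₀ hx₀)
  obtain ⟨b, hb, k, hk⟩ := exists_blocks hg (not_lt_zero.elim <| · ▸ hG x₀ hx₀)
  refine otype_le_of_subset_iUnion (ι := Fin n × Fin k)
    (Z := fun i => {x | x ∈ X ∧ (ω ^ a * (i.1 : ℕ) ≤ F x ∧ F x - ω ^ a * (i.1 : ℕ) < ω ^ a) ∧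
      (ω ^ b * (i.2 : ℕ) ≤ G x ∧ G x - ω ^ b * (i.2 : ℕ) < ω ^ b)}) (fun i => ?_) fun x hx => ?_
  · refine (otype_le_of_product a b _ (fun x => F x - ω ^ a * (i.1 : ℕ))
      (fun x => G x - ω ^ b * (i.2 : ℕ)) (fun x hx => hx.2.1.2) (fun x hx => hx.2.2.2)
      fun x hx y hy h1 h2 => hfg x hx.1 y hy.1 ?_ ?_).trans_lt
        ((opow_lt_opow_iff_right one_lt_omega0).2 (hcd a ha b hb))
    · exact le_of_otype_inter_Iio_le (Set.mem_image_of_mem f hy.1)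
        (le_of_tsub_le_tsub_of_le hx.2.1.1 hy.2.1.1 h1)
    · exact le_of_otype_inter_Iio_le (Set.mem_image_of_mem g hy.1)
        (le_of_tsub_le_tsub_of_le hx.2.2.1 hy.2.2.1 h2)
  · obtain ⟨i, hi⟩ := hn _ (hF x hx)
    obtain ⟨j, hj⟩ := hk _ (hG x hx)
    exact Set.mem_iUnion.2 ⟨(i, j), hx, hi, hj⟩

end otype

/-! ### Order types of fibres of word presentations -/

open Classical in
/-- The word that agrees with `u` on `I` and with `w` elsewhere. -/
noncomputable def patch {L : Type u} {A : Type} (I : Set L) (u w : L → A) : L → A :=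
  fun l => if l ∈ I then u l else w l

section patch

variable {L : Type u} {A : Type} {I : Set L} {u w : L → A} {l : L}

theorem patch_of_mem (h : l ∈ I) : patch I u w l = u l := if_pos h

theorem patch_of_notMem (h : l ∉ I) : patch I u w l = w l := if_neg h

theorem patch_self : patch I w w = w := by
  funext l; simp [patch]

theorem patch_eq_right (h : ∀ l ∈ I, u l = w l) : patch I u w = w := by
  funext l
  by_cases hl : l ∈ I
  · rw [patch_of_mem hl, h l hl]
  · rw [patch_of_notMem hl]

end patch

/-- The relation `R` on words is the image of the order of `V` under the injection `e`. -/
structure IsWordPresentation {L V : Type u} [LE V] {A : Type} (e : V → L → A)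
    (R : (L → A) → (L → A) → Prop) : Prop where
  inj : Function.Injective e
  rel : ∀ w w', R w w' ↔ ∃ x y, x ≤ y ∧ w = e x ∧ w' = e y

/-- The pairs of words on `I` fall into classes, named by the elements of `Θ`, that contexts
outside of `I` cannot distinguish with respect to `R`. -/
def IsTypeMap {L : Type u} {A Θ : Type} (R : (L → A) → (L → A) → Prop) (I : Set L)
    (t : (L → A) → (L → A) → Θ) : Prop :=
  ∀ u₁ u₂ v₁ v₂, t u₁ u₂ = t v₁ v₂ → ∀ w₁ w₂,
    R (patch I u₁ w₁) (patch I u₂ w₂) → R (patch I v₁ w₁) (patch I v₂ w₂)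

/-- The elements whose words agree with the word of `v` outside of `S`. -/
def fibre {L V : Type u} {A : Type} (e : V → L → A) (S : Set L) (v : V) : Set V :=
  {x | ∀ l ∉ S, e x l = e v l}

/-- All fibres over `S` have order type below `ω ^ c`. -/
def FibreBound {L V : Type u} [LinearOrder V] [WellFoundedLT V] {A : Type} (e : V → L → A)
    (c : Ordinal.{u}) (S : Set L) : Prop :=
  ∀ v, otype (fibre e S v) < ω ^ c

section presentation

set_option linter.unusedSectionVars false

variable {L V : Type u} [LinearOrder L] [LinearOrder V] [WellFoundedLT V] {A Θ : Type}
  {e : V → L → A} {R : (L → A) → (L → A) → Prop}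

/-! ### Hybrid words and bounds on fibres. -/

theorem IsWordPresentation.rel_iff (hR : IsWordPresentation e R) {x y : V} :
    R (e x) (e y) ↔ x ≤ y := by
  rw [hR.rel]
  constructor
  · rintro ⟨a, b, h, h1, h2⟩
    rwa [hR.inj h1, hR.inj h2]
  · intro h
    exact ⟨x, y, h, rfl, rfl⟩

/-- The types for which a context given by `x` makes the relation true. -/
def contextSet (e : V → L → A) (R : (L → A) → (L → A) → Prop) (I : Set L)
    (t : (L → A) → (L → A) → Θ) (x : V) : Set Θ :=
  {θ | ∃ u u', t u u' = θ ∧ R (patch I u (e x)) (patch I u' (e x))}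

/-- Elements with the same type on `I` and the same context outside of `I` are ordered like a
subset of a product. -/
theorem IsWordPresentation.exists_product (hR : IsWordPresentation e R) {I : Set L}
    {t : (L → A) → (L → A) → Θ} (ht : IsTypeMap R I t) {X : Set V} {x₀ : V}
    (h₁ : ∀ x ∈ X, t (e x) (e x) = t (e x₀) (e x₀))
    (h₂ : ∀ x ∈ X, contextSet e R I t x = contextSet e R I t x₀) :
    ∃ f g : V → V, (∀ x ∈ X, e (f x) = patch I (e x) (e x₀)) ∧
      (∀ x ∈ X, e (g x) = patch I (e x₀) (e x)) ∧
      ∀ x ∈ X, ∀ y ∈ X, f x ≤ f y → g x ≤ g y → x ≤ y := by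
  have hf : ∀ x : V, ∃ y, x ∈ X → e y = patch I (e x) (e x₀) := by
    intro x
    by_cases hx : x ∈ X
    -- A word lies in the range of `e` as soon as it is `R`-related to itself; equality of types on
    -- the diagonal transfers this from `x₀` to the hybrid word.
    · have : R (patch I (e x) (e x₀)) (patch I (e x) (e x₀)) := by
        refine ht _ _ _ _ (h₁ x hx).symm _ _ ?_
        rw [patch_self, hR.rel_iff]
      obtain ⟨y, -, -, hy, -⟩ := (hR.rel _ _).1 this
      exact ⟨y, fun _ => hy.symm⟩
    · exact ⟨x, fun h => absurd h hx⟩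
  have hg : ∀ x : V, ∃ y, x ∈ X → e y = patch I (e x₀) (e x) := by
    intro x
    by_cases hx : x ∈ X
    · have : R (patch I (e x₀) (e x)) (patch I (e x₀) (e x)) := by
        refine ht _ _ _ _ (h₁ x hx) _ _ ?_
        rw [patch_self, hR.rel_iff]
      obtain ⟨y, -, -, hy, -⟩ := (hR.rel _ _).1 this
      exact ⟨y, fun _ => hy.symm⟩
    · exact ⟨x, fun h => absurd h hx⟩
  choose f hf using hf
  choose g hg using hg
  refine ⟨f, g, hf, hg, fun x hx y hy hfxy hgxy => ?_⟩
  rw [← hR.rel_iff, hf x hx, hf y hy] at hfxy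
  rw [← hR.rel_iff, hg x hx, hg y hy] at hgxy
  -- The chain goes through the hybrid `z` with the word of `y` on `I` and that of `x` elsewhere.
  -- Equal contexts turn `f x ≤ f y` into `x ≤ z`; equal diagonal types turn `g x ≤ g y` into `z ≤
  -- y`.
  have h3 : t (e x) (e y) ∈ contextSet e R I t x := by
    rw [h₂ x hx]
    exact ⟨_, _, rfl, hfxy⟩
  obtain ⟨u, u', hu, hr⟩ := h3
  have h4 := ht _ _ _ _ hu _ _ hr
  rw [patch_self] at h4
  have h5 := ht _ _ _ _ (h₁ y hy).symm _ _ hgxy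
  rw [patch_self] at h5
  obtain ⟨z, -, -, hz, -⟩ := (hR.rel _ _).1 h5
  rw [hz] at h4 h5
  exact (hR.rel_iff.1 h4).trans (hR.rel_iff.1 h5)

/-- Sort the fibre by diagonal type and context on `I`, which gives finitely many pieces. On each,
`f` maps into a fibre over `I` and `g` into a fibre over `S`, and `ω ^ m` is closed under natural
sums. -/
theorem FibreBound.union (hR : IsWordPresentation e R) [Finite Θ] {I S : Set L}
    {t : (L → A) → (L → A) → Θ} (ht : IsTypeMap R I t) {m : Ordinal.{u}}
    (hS : FibreBound e (ω ^ m) S) (hI : FibreBound e (ω ^ m) I) :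
    FibreBound e (ω ^ m) (S ∪ I) := by
  intro v
  refine otype_le_of_subset_iUnion (ι := Θ × Set Θ)
    (Z := fun i => {x | x ∈ fibre e (S ∪ I) v ∧ t (e x) (e x) = i.1 ∧ contextSet e R I t x = i.2})
    (fun i => ?_) (fun x hx => Set.mem_iUnion.2 ⟨(_, _), hx, rfl, rfl⟩)
  set X := {x | x ∈ fibre e (S ∪ I) v ∧ t (e x) (e x) = i.1 ∧ contextSet e R I t x = i.2} with hX
  rcases X.eq_empty_or_nonempty with h0 | ⟨x₀, hx₀⟩
  · rw [h0, otype_empty]; exact opow_pos _ omega0_pos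
  obtain ⟨f, g, hf, hg, hfg⟩ := hR.exists_product ht (X := X) (x₀ := x₀)
    (fun x hx => hx.2.1.trans hx₀.2.1.symm) (fun x hx => hx.2.2.trans hx₀.2.2.symm)
  refine otype_lt_of_product (d := ω ^ m) (hsum_lt_omega0_opow m)
    ((otype_mono ?_).trans_lt (hI x₀)) ((otype_mono ?_).trans_lt (hS x₀)) hfg
  · rintro _ ⟨x, hx, rfl⟩ l hl
    rw [hf x hx, patch_of_notMem hl]
  · rintro _ ⟨x, hx, rfl⟩ l hl
    rw [hg x hx]
    by_cases hlI : l ∈ I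
    · rw [patch_of_mem hlI]
    · rw [patch_of_notMem hlI, hx.1 l (by simp [hl, hlI]), hx₀.1 l (by simp [hl, hlI])]

/-- If a fibre were too long, it would contain markers `p k` with exactly `ω ^ (ω ^ m * k)` elements
below them, for every `k`. Take more markers than there are codes, and a tail `I` on which these
markers are blank. By pigeonhole, large pieces below two markers `p k` and `p k'`, with `k < k'`,
share a code. Transplanting the tails of the elements below `p k'` onto one element `x₀` below `p k`
keeps them below `p k`, so the first coordinate has type at most `ω ^ (ω ^ m * k)`. The second
ranges over a fibre of `S \ I` and is below `ω ^ (ω ^ m)`. Their product cannot reach `ω ^ (ω ^ m *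
k')`. -/
theorem FibreBound.of_tails (hR : IsWordPresentation e R) [Finite Θ] {blank : A}
    (hfin : ∀ x, {l | e x l ≠ blank}.Finite)
    (ht : ∀ I : Set L, I.OrdConnected → ∃ t : (L → A) → (L → A) → Θ, IsTypeMap R I t)
    {m : Ordinal.{u}} {S : Set L} (h : ∀ F : Set L, F.Finite → ∃ I ⊆ S, I.OrdConnected ∧
      Disjoint I F ∧ FibreBound e (ω ^ m) (S \ I)) :
    FibreBound e (ω ^ (m + 1)) S := by
  intro v
  by_contra! hge
  have hmlt : ∀ k k' : ℕ, k < k' → (ω : Ordinal.{u}) ^ (ω ^ m * (k : Ordinal.{u})) <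
      ω ^ (ω ^ m * (k' : Ordinal.{u})) := fun k k' hk => by
    rw [opow_lt_opow_iff_right one_lt_omega0]
    exact (mul_lt_mul_iff_right₀ (opow_pos m omega0_pos)).2 (by exact_mod_cast hk)
  have hp : ∀ k : ℕ, ∃ p ∈ fibre e S v,
      otype (fibre e S v ∩ Set.Iio p) = ω ^ (ω ^ m * (k : Ordinal.{u})) := fun k => by
    refine exists_otype_inter_Iio_eq (lt_of_lt_of_le ?_ hge)
    rw [opow_lt_opow_iff_right one_lt_omega0]
    exact opow_mul_lt_opow (natCast_lt_omega0 _) (Order.lt_add_one_iff.2 le_rfl)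
  choose p hpS hpo using hp
  let Ξ := Θ × Θ × Set Θ
  let K := Nat.card Ξ
  obtain ⟨I, hIS, hI, hIF, hb⟩ := h (⋃ k : Fin (K + 1), {l | e (p k) l ≠ blank})
    (Set.finite_iUnion fun k => hfin _)
  obtain ⟨t, ht⟩ := ht I hI
  let w₀ : L → A := fun _ => blank
  have hpb : ∀ k : Fin (K + 1), patch I w₀ (e (p k)) = e (p k) := fun k =>
    patch_eq_right fun l hl => by
      by_contra hne
      exact Set.disjoint_left.1 hIF hl (Set.mem_iUnion.2 ⟨k, fun h => hne h.symm⟩)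
  -- The middle entry compares the tail of `x` with the blank tail of the markers; the other two are
  -- what the product decomposition needs.
  let code : V → Ξ := fun x => (t (e x) (e x), t w₀ (e x), contextSet e R I t x)
  let X : Fin (K + 1) → Ξ → Set V := fun k ξ =>
    {x | x ∈ fibre e S v ∧ x < p k ∧ code x = ξ}
  -- A power of `ω` is not a finite union of sets whose types are smaller, so some code class below
  -- `p k` is as long as the whole segment.
  have hbig : ∀ k : Fin (K + 1), ∃ ξ, ω ^ (ω ^ m * ((k : ℕ) : Ordinal.{u})) ≤ otype (X k ξ) := by
    intro k
    by_contra! hlt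
    refine (otype_le_of_subset_iUnion (X := fibre e S v ∩ Set.Iio (p k)) hlt ?_).ne (hpo k)
    exact fun x hx => Set.mem_iUnion.2 ⟨code x, hx.1, hx.2, rfl⟩
  choose ξ hξ using hbig
  obtain ⟨k, k', hkk, hξe⟩ : ∃ k k' : Fin (K + 1), k < k' ∧ ξ k = ξ k' := by
    by_contra! hne
    have hinj : Function.Injective ξ := by
      intro a b hab
      rcases lt_trichotomy a b with h1 | h1 | h1
      · exact absurd hab (hne _ _ h1)
      · exact h1
      · exact absurd hab.symm (hne _ _ h1)
    have := Nat.card_le_card_of_injective ξ hinj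
    simp [K] at this
  obtain ⟨x₀, hx₀⟩ : (X k (ξ k)).Nonempty := by
    rw [Set.nonempty_iff_ne_empty]
    intro h0
    have := hξ k
    rw [h0, otype_empty] at this
    exact absurd this (not_le.2 (opow_pos _ omega0_pos))
  obtain ⟨hx₀S, hx₀p, hx₀c⟩ := hx₀
  have hcode : ∀ x ∈ X k' (ξ k'), t (e x) (e x) = t (e x₀) (e x₀) ∧
      t w₀ (e x) = t w₀ (e x₀) ∧ contextSet e R I t x = contextSet e R I t x₀ := fun x hx => by
    have h : code x = code x₀ := hx.2.2.trans (hξe.symm.trans hx₀c.symm)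
    exact ⟨congrArg (fun c => c.1) h, congrArg (fun c => c.2.1) h, congrArg (fun c => c.2.2) h⟩
  obtain ⟨f, g, hf, hg, hfg⟩ := hR.exists_product ht (X := X k' (ξ k')) (x₀ := x₀)
    (fun x hx => (hcode x hx).1) (fun x hx => (hcode x hx).2.2)
  refine absurd (hξ k') (not_le.2 ?_)
  refine otype_lt_of_product (d := ω ^ m) (fun a ha b hb => hsum_lt_omega0_opow_mul ha hb)
    ((otype_mono (Y := fibre e S v ∩ Set.Iio (p k)) ?_).trans_lt
      ((hpo k).trans_lt (hmlt k k' hkk))) ((otype_mono ?_).trans_lt (hb x₀)) hfg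
  · rintro _ ⟨x, hx, rfl⟩
    refine ⟨fun l hl => ?_, ?_⟩
    · rw [hf x hx, patch_of_notMem fun h => hl (hIS h), hx₀S l hl]
    · change f x < p k
      -- If `p k ≤ f x`, then, since `p k` is blank on `I`, exchanging the tail of `x` for that of
      -- `x₀` gives `p k ≤ x₀`, against the choice of `x₀`.
      rw [← not_le, ← hR.rel_iff, hf x hx, ← hpb k]
      intro hr
      have := ht _ _ _ _ (hcode x hx).2.1 _ _ hr
      rw [hpb, patch_self, hR.rel_iff] at this
      exact absurd hx₀p (not_lt.2 this)
  · rintro _ ⟨x, hx, rfl⟩ l hl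
    rw [hg x hx]
    by_cases hlI : l ∈ I
    · rw [patch_of_mem hlI]
    · have : l ∉ S := fun h => hl ⟨h, hlI⟩
      rw [patch_of_notMem hlI, hx.1 l this, hx₀S l this]

theorem FibreBound.of_subsingleton (hR : IsWordPresentation e R) [Finite A] {S : Set L}
    (hS : S.Subsingleton) {c : Ordinal.{u}} (hc : c ≠ 0) : FibreBound e c S := by
  intro v
  have hfin : (fibre e S v).Finite := by
    rcases S.eq_empty_or_nonempty with rfl | ⟨a, ha⟩
    · refine Set.Subsingleton.finite fun x hx y hy => hR.inj (funext fun l => ?_)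
      rw [hx l (Set.notMem_empty l), hy l (Set.notMem_empty l)]
    · refine Set.Finite.of_injOn (f := fun x => e x a) (t := Set.univ) (fun _ _ => trivial) ?_
        Set.finite_univ
      intro x hx y hy hxy
      refine hR.inj (funext fun l => ?_)
      by_cases hl : l ∈ S
      · rw [hS hl ha]; exact hxy
      · rw [hx l hl, hy l hl]
  have := hfin.to_subtype
  refine otype_le_of_subset_iUnion (ι := fibre e S v) (Z := fun x => {x.1}) (fun x => ?_)
    fun x hx => Set.mem_iUnion.2 ⟨⟨x, hx⟩, rfl⟩
  refine (otype_le_of_forall (o := 1) ?_).trans_lt (one_lt_opow.2 ⟨one_lt_omega0, hc⟩)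
  rintro y rfl
  rw [Set.singleton_inter_eq_empty.2 (by simp), otype_empty]
  exact zero_lt_one

/-! ### Induction over the condensation classes. -/

/-- The class of `x` with respect to `∼_α`. -/
def condClass (α : Ordinal.{u}) (x : L) : Set L := {w | condRel L α x w}

theorem condClass_eq_iff {α : Ordinal.{u}} {x y : L} :
    condClass α x = condClass α y ↔ condRel L α x y := by
  have he := (condRel_facts (L := L) α).1
  constructor
  · intro h
    have : y ∈ condClass α y := he.refl y
    rwa [← h] at this
  · intro h
    ext w
    exact ⟨fun hw => he.trans (he.symm h) hw, fun hw => he.trans h hw⟩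

/-- The traces of the classes on `C` are again intervals, so they have type maps and can be adjoined
one at a time. -/
theorem FibreBound.of_finite_classes (hR : IsWordPresentation e R) [Finite A] [Finite Θ]
    (ht : ∀ I : Set L, I.OrdConnected → ∃ t : (L → A) → (L → A) → Θ, IsTypeMap R I t)
    {m : Ordinal.{u}}
    (ih : ∀ C : Set L, C.OrdConnected → (∀ x ∈ C, ∀ y ∈ C, condRel L m x y) →
      FibreBound e (ω ^ m) C) {C : Set L} (hC : C.OrdConnected)
    (hfin : (condClass m '' C).Finite) : FibreBound e (ω ^ m) C := by
  classical
  let P : Set L → Set L := fun κ => {z | z ∈ C ∧ condClass m z = κ}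
  have hP : ∀ κ, (P κ).OrdConnected := by
    refine fun κ => ⟨fun x hx y hy z hz => ⟨hC.out hx.1 hy.1 hz, ?_⟩⟩
    rw [← hx.2, condClass_eq_iff]
    have hxy : condRel L m x y := condClass_eq_iff.1 (hx.2.trans hy.2.symm)
    exact (condRel_facts m).1.symm
      ((condRel_facts m).2.1 x y hxy z (Set.Icc_subset_uIcc hz))
  have key : ∀ s : Finset (Set L), FibreBound e (ω ^ m) (⋃ κ ∈ s, P κ) := by
    intro s
    induction s using Finset.induction_on with
    | empty =>
      refine FibreBound.of_subsingleton hR ?_ (opow_ne_zero _ omega0_ne_zero)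
      simp
    | insert a s ha ih' =>
      rw [Finset.set_biUnion_insert, Set.union_comm]
      obtain ⟨t, ht⟩ := ht (P a) (hP a)
      refine FibreBound.union hR ht ih' (ih _ (hP a) fun x hx y hy => ?_)
      exact condClass_eq_iff.1 (hx.2.trans hy.2.symm)
  convert key hfin.toFinset
  ext z
  simp only [Set.Finite.mem_toFinset, Set.mem_iUnion, P]
  exact ⟨fun h => ⟨_, ⟨z, h, rfl⟩, h, rfl⟩, fun ⟨_, _, h⟩ => h.1⟩

/-- A `∼_(m+1)`-class is cut at a point `a`. Between `a` and any other point lie finitely many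
`∼_m`-classes, so on each side the tail argument applies: a finite set of positions is left behind
after such a bounded piece. The two sides are then joined. -/
theorem FibreBound.of_class (hR : IsWordPresentation e R) [Finite A] [Finite Θ] {blank : A}
    (hfin : ∀ x, {l | e x l ≠ blank}.Finite)
    (ht : ∀ I : Set L, I.OrdConnected → ∃ t : (L → A) → (L → A) → Θ, IsTypeMap R I t) (m : ℕ) :
    ∀ C : Set L, C.OrdConnected → (∀ x ∈ C, ∀ y ∈ C, condRel L m x y) →
      FibreBound e (ω ^ (m : Ordinal.{u})) C := by
  induction m with
  | zero =>
    intro C _ h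
    refine FibreBound.of_subsingleton hR (fun x hx y hy => ?_) (opow_ne_zero _ omega0_ne_zero)
    simpa [condRel_zero] using h x hx y hy
  | succ m ih =>
    intro C hC h
    rcases C.eq_empty_or_nonempty with rfl | ⟨a, ha⟩
    · exact FibreBound.of_subsingleton hR (by simp) (opow_ne_zero _ omega0_ne_zero)
    push_cast at h ⊢
    have hIcc : ∀ x ∈ C, ∀ y ∈ C, FibreBound e (ω ^ (m : Ordinal.{u})) (Set.Icc x y) := by
      intro x hx y hy
      refine FibreBound.of_finite_classes hR ht ih Set.ordConnected_Icc ?_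
      exact ((condRel_succ _ _ _).1 (h x hx y hy)).subset (Set.image_mono Set.Icc_subset_uIcc)
    have hr : FibreBound e (ω ^ ((m : Ordinal.{u}) + 1)) (C ∩ Set.Ici a) := by
      refine FibreBound.of_tails hR hfin ht fun F hF => ?_
      -- Inserting `a` supplies a maximum even when `F` misses this side.
      obtain ⟨b, hb, hbmax⟩ := Set.exists_max_image (insert a (F ∩ (C ∩ Set.Ici a))) id
        ((hF.inter_of_left _).insert a) ⟨a, Set.mem_insert _ _⟩
      have hbC : b ∈ C ∧ a ≤ b := by
        rcases hb with rfl | hb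
        · exact ⟨ha, le_rfl⟩
        · exact hb.2
      refine ⟨C ∩ Set.Ioi b, fun z hz => ⟨hz.1, hbC.2.trans (le_of_lt hz.2)⟩,
        hC.inter Set.ordConnected_Ioi, ?_, ?_⟩
      · rw [Set.disjoint_left]
        intro z hz hzF
        exact absurd (hbmax z (Or.inr ⟨hzF, hz.1, hbC.2.trans (le_of_lt hz.2)⟩)) (not_le.2 hz.2)
      · convert hIcc a ha b hbC.1 using 1
        ext z
        simp only [Set.mem_sdiff, Set.mem_inter_iff, Set.mem_Ici, Set.mem_Ioi, Set.mem_Icc, not_and,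
          not_lt]
        exact ⟨fun hz => ⟨hz.1.2, hz.2 hz.1.1⟩,
          fun hz => ⟨⟨hC.out ha hbC.1 hz, hz.1⟩, fun _ => hz.2⟩⟩
    have hl : FibreBound e (ω ^ ((m : Ordinal.{u}) + 1)) (C ∩ Set.Iio a) := by
      refine FibreBound.of_tails hR hfin ht fun F hF => ?_
      -- This side does not contain `a`; if `F` misses it, the whole side serves as the tail.
      rcases (F ∩ (C ∩ Set.Iio a)).eq_empty_or_nonempty with h0 | hne
      · refine ⟨C ∩ Set.Iio a, subset_rfl, hC.inter Set.ordConnected_Iio, ?_, ?_⟩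
        · rw [Set.disjoint_left]
          intro z hz hzF
          have : z ∈ F ∩ (C ∩ Set.Iio a) := ⟨hzF, hz⟩
          rw [h0] at this
          exact this
        · rw [sdiff_self]
          exact FibreBound.of_subsingleton hR (by simp) (opow_ne_zero _ omega0_ne_zero)
      obtain ⟨b, hb, hbmin⟩ := Set.exists_min_image (F ∩ (C ∩ Set.Iio a)) id
        (hF.inter_of_left _) hne
      have hfb : FibreBound e (ω ^ (m : Ordinal.{u})) (Set.Ico b a) := by
        refine FibreBound.of_finite_classes hR ht ih Set.ordConnected_Ico ?_
        exact ((condRel_succ _ _ _).1 (h b hb.2.1 a ha)).subset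
          (Set.image_mono (Set.Ico_subset_Icc_self.trans Set.Icc_subset_uIcc))
      refine ⟨C ∩ Set.Iio b, fun z hz => ⟨hz.1, lt_trans hz.2 hb.2.2⟩,
        hC.inter Set.ordConnected_Iio, ?_, ?_⟩
      · rw [Set.disjoint_left]
        intro z hz hzF
        exact absurd (hbmin z ⟨hzF, hz.1, lt_trans hz.2 hb.2.2⟩) (not_le.2 hz.2)
      · convert hfb using 1
        ext z
        simp only [Set.mem_sdiff, Set.mem_inter_iff, Set.mem_Iio, Set.mem_Ico, not_and, not_lt]
        exact ⟨fun hz => ⟨hz.2 hz.1.1, hz.1.2⟩,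
          fun hz => ⟨⟨hC.out hb.2.1 ha ⟨hz.1, hz.2.le⟩, hz.2⟩, fun _ => hz.1⟩⟩
    obtain ⟨t, ht⟩ := ht (C ∩ Set.Iio a) (hC.inter Set.ordConnected_Iio)
    have := FibreBound.union hR ht hr hl
    rwa [← Set.inter_union_distrib_left, Set.union_comm, Set.Iio_union_Ici,
      Set.inter_univ] at this

/-- A well-order with a finite word presentation on `L` whose relation has finitely many types on
intervals, uniformly. -/
theorem IsWordPresentation.type_lt (hR : IsWordPresentation e R) [Finite A] [Finite Θ] {blank : A}
    (hfin : ∀ x, {l | e x l ≠ blank}.Finite)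
    (ht : ∀ I : Set L, I.OrdConnected → ∃ t : (L → A) → (L → A) → Θ, IsTypeMap R I t) {m : ℕ}
    (hm : Finite (Quotient (condSetoid L m))) :
    typeLT V < ω ^ (ω ^ (m : Ordinal.{u})) := by
  rcases isEmpty_or_nonempty V with hV | ⟨⟨v⟩⟩
  · rw [type_eq_zero_of_empty]; exact opow_pos _ omega0_pos
  have hfc : (condClass (m : Ordinal.{u}) '' (Set.univ : Set L)).Finite := by
    rw [Set.image_univ]
    refine (Set.finite_range (Quotient.lift (s := condSetoid L m) (condClass (m : Ordinal.{u}))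
      fun a b h => condClass_eq_iff.2 h)).subset ?_
    rintro _ ⟨x, rfl⟩
    exact ⟨Quotient.mk _ x, rfl⟩
  have h := FibreBound.of_finite_classes hR ht (FibreBound.of_class hR hfin ht m)
    Set.ordConnected_univ hfc v
  refine lt_of_eq_of_lt ?_ h
  have huniv : fibre e Set.univ v = Set.univ := by ext; simp [fibre]
  rw [huniv, otype]
  exact (OrderIso.Set.univ (α := V)).symm.toRelIsoLT.ordinalType_congr

end presentation

/-! ### Runs on intervals of cuts -/

section runs

variable {L : Type u} [LinearOrder L] {A : Type}

/-! ### Cuts and locality of runs. -/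

theorem Cut.le_Iio_of_notMem {a : Cut L} {l : L} (h : l ∉ a) : a ≤ LowerSet.Iio l :=
  fun _ hx => LowerSet.mem_Iio_iff.2 (not_le.1 fun hlx => h (a.lower hlx hx))

theorem Cut.Iic_le_of_mem {b : Cut L} {l : L} (h : l ∈ b) : LowerSet.Iic l ≤ b :=
  LowerSet.Iic_le.2 h

theorem Cut.Iio_le_Iic (l : L) : (LowerSet.Iio l : Cut L) ≤ LowerSet.Iic l :=
  Cut.le_Iio_of_notMem (a := LowerSet.Iio l) (by simp) |>.trans
    fun _ hx => LowerSet.mem_Iic_iff.2 (le_of_lt (LowerSet.mem_Iio_iff.1 hx))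

theorem limBelow_congr {Q : Type} {r r' : Cut L → Q} {a c : Cut L} (hac : a < c)
    (h : ∀ x, a ≤ x → x < c → r x = r' x) : limBelow r c = limBelow r' c := by
  ext q
  constructor <;> intro hq d hd <;> obtain ⟨x, hx, hxc, rfl⟩ := hq (max a d) (max_lt hac hd)
  · exact ⟨x, (le_max_right _ _).trans hx, hxc, (h x ((le_max_left _ _).trans hx) hxc).symm⟩
  · exact ⟨x, (le_max_right _ _).trans hx, hxc, h x ((le_max_left _ _).trans hx) hxc⟩

theorem limAbove_congr {Q : Type} {r r' : Cut L → Q} {b c : Cut L} (hcb : c < b)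
    (h : ∀ x, c < x → x ≤ b → r x = r' x) : limAbove r c = limAbove r' c := by
  ext q
  constructor <;> intro hq d hd <;> obtain ⟨x, hx, hxc, rfl⟩ := hq (min b d) (lt_min hcb hd)
  · exact ⟨x, hx, hxc.trans (min_le_right _ _), (h x hx (hxc.trans (min_le_left _ _))).symm⟩
  · exact ⟨x, hx, hxc.trans (min_le_right _ _), h x hx (hxc.trans (min_le_left _ _))⟩

/-- `r` satisfies the conditions on runs between the cuts `a` and `b`. -/
structure LimitAutomaton.IsRunOn (M : LimitAutomaton A) (w : L → A) (a b : Cut L)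
    (r : Cut L → M.Q) : Prop where
  succ : ∀ l, l ∉ a → l ∈ b → (r (LowerSet.Iio l), w l, r (LowerSet.Iic l)) ∈ M.succTrans
  right : ∀ c, a < c → c ≤ b → (¬ ∃ d, d ⋖ c) → (limBelow r c, r c) ∈ M.rightLimTrans
  left : ∀ c, a ≤ c → c < b → (¬ ∃ d, c ⋖ d) → (r c, limAbove r c) ∈ M.leftLimTrans

namespace LimitAutomaton

variable {M : LimitAutomaton A} {w w' : L → A} {a b c : Cut L} {r r' : Cut L → M.Q}

theorem isRun_iff_isRunOn : M.IsRun w r ↔ M.IsRunOn w ⊥ ⊤ r := by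
  constructor
  · intro h
    exact ⟨fun l _ _ => h.succ l, fun c hc _ => h.right c hc.ne', fun c _ hc => h.left c hc.ne⟩
  · intro h
    exact ⟨fun l => h.succ l (LowerSet.notMem_bot) (LowerSet.mem_top),
      fun c hc => h.right c (bot_lt_iff_ne_bot.2 hc) le_top,
      fun c hc => h.left c bot_le (lt_top_iff_ne_top.2 hc)⟩

theorem IsRunOn.mono (h : M.IsRunOn w a b r) {a' b' : Cut L} (ha : a ≤ a') (hb : b' ≤ b) :
    M.IsRunOn w a' b' r :=
  ⟨fun l hl hl' => h.succ l (fun h => hl (ha h)) (hb hl'),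
    fun c hc hc' => h.right c (ha.trans_lt hc) (hc'.trans hb),
    fun c hc hc' => h.left c (ha.trans hc) (hc'.trans_le hb)⟩

theorem IsRunOn.trans (h : M.IsRunOn w a b r) (h' : M.IsRunOn w b c r) : M.IsRunOn w a c r := by
  refine ⟨fun l hl hl' => ?_, fun x hx hx' => ?_, fun x hx hx' => ?_⟩
  · by_cases hb : l ∈ b
    · exact h.succ l hl hb
    · exact h'.succ l hb hl'
  · rcases le_or_gt x b with hb | hb
    · exact h.right x hx hb
    · exact h'.right x hb hx'
  · rcases lt_or_ge x b with hb | hb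
    · exact h.left x hx hb
    · exact h'.left x hb hx'

theorem IsRunOn.congr (h : M.IsRunOn w a b r) (hw : ∀ l, l ∉ a → l ∈ b → w l = w' l)
    (hr : ∀ x, a ≤ x → x ≤ b → r x = r' x) : M.IsRunOn w' a b r' := by
  refine ⟨fun l hl hl' => ?_, fun x hx hx' hn => ?_, fun x hx hx' hn => ?_⟩
  · rw [← hw l hl hl', ← hr _ (Cut.le_Iio_of_notMem hl)
      ((Cut.Iio_le_Iic l).trans (Cut.Iic_le_of_mem hl')),
      ← hr _ ((Cut.le_Iio_of_notMem hl).trans (Cut.Iio_le_Iic l)) (Cut.Iic_le_of_mem hl')]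
    exact h.succ l hl hl'
  · rw [← limBelow_congr hx fun y hy hy' => hr y hy (hy'.le.trans hx'), ← hr x hx.le hx']
    exact h.right x hx hx' hn
  · rw [← limAbove_congr hx' fun y hy hy' => hr y (hx.trans hy.le) hy', ← hr x hx hx'.le]
    exact h.left x hx hx' hn

/-- Cut and paste: the run conditions are local, so the stretch of an accepting run between `a` and
`b` may be exchanged for any run on the new letters with the same end states. -/
theorem Accepts.replace {v v' : L → A} (hab : a ≤ b) (hv : M.Accepts v)
    (hwv : ∀ l, l ∉ a → l ∈ b → w l = v l) (hwv' : ∀ l, l ∉ a → l ∈ b → w' l = v' l)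
    (hvv : ∀ l, (l ∈ a ∨ l ∉ b) → v l = v' l)
    (ht : ∀ p q : M.Q, (∃ r, M.IsRunOn w a b r ∧ r a = p ∧ r b = q) →
      ∃ r, M.IsRunOn w' a b r ∧ r a = p ∧ r b = q) : M.Accepts v' := by
  classical
  obtain ⟨r, hr, hi, hf⟩ := hv
  rw [isRun_iff_isRunOn] at hr
  obtain ⟨s, hs, hsa, hsb⟩ := ht (r a) (r b) ⟨r, (hr.mono bot_le le_top).congr
    (fun l hl hl' => (hwv l hl hl').symm) (fun _ _ _ => rfl), rfl, rfl⟩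
  let r' : Cut L → M.Q := fun c => if a ≤ c ∧ c ≤ b then s c else r c
  have h1 : ∀ x ≤ a, r' x = r x := by
    intro x hx
    rcases hx.eq_or_lt with rfl | hx
    · simp [r', hab, hsa]
    · simp [r', not_le.2 hx]
  have h2 : ∀ x, b ≤ x → r' x = r x := by
    intro x hx
    rcases hx.eq_or_lt with rfl | hx
    · simp [r', hab, hsb]
    · simp [r', not_le.2 hx]
  have h3 : ∀ x, a ≤ x → x ≤ b → r' x = s x := fun x hx hx' => by simp [r', hx, hx']
  refine ⟨r', isRun_iff_isRunOn.2 (IsRunOn.trans (b := a) ?_ (IsRunOn.trans (b := b) ?_ ?_)), ?_, ?_⟩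
  · exact (hr.mono le_rfl le_top).congr (fun l _ hl => hvv l (Or.inl hl))
      fun x _ hx => (h1 x hx).symm
  · exact hs.congr hwv' fun x hx hx' => (h3 x hx hx').symm
  · exact (hr.mono bot_le le_rfl).congr (fun l hl _ => hvv l (Or.inr hl))
      fun x hx _ => (h2 x hx).symm
  · rwa [h1 _ bot_le]
  · rwa [h2 _ le_top]

/-- The relation recognized by an automaton has finitely many types on intervals. -/
theorem exists_isTypeMap {B Ω : Type} (N : LimitAutomaton (B × B × Ω)) (o : L → Ω) {I : Set L}
    (hI : I.OrdConnected) : ∃ t : (L → B) → (L → B) → Set (N.Q × N.Q),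
      IsTypeMap (fun w w' => N.Accepts (conv w (conv w' o))) I t := by
  -- The cuts just below and just above `I`; convexity makes `b` a lower set, and `I` consists of
  -- the points in `b` but not in `a`.
  let a : Cut L := ⟨{l | ∀ i ∈ I, l < i}, fun x y hyx hx i hi => hyx.trans_lt (hx i hi)⟩
  let b : Cut L := ⟨{l | l ∈ a ∨ l ∈ I}, by
    rintro x y hyx (hx | hx)
    · exact Or.inl (a.lower hyx hx)
    · by_cases hy : ∀ i ∈ I, y < i
      · exact Or.inl hy
      · push Not at hy
        obtain ⟨i, hi, hiy⟩ := hy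
        exact Or.inr (hI.out hi hx ⟨hiy, hyx⟩)⟩
  have hab : a ≤ b := fun x hx => Or.inl hx
  have hmem : ∀ l, l ∉ a → l ∈ b → l ∈ I := fun l hl hl' => hl'.resolve_left hl
  have hnmem : ∀ l, (l ∈ a ∨ l ∉ b) → l ∉ I := by
    rintro l (hl | hl) hlI
    · exact lt_irrefl _ (hl l hlI)
    · exact hl (Or.inr hlI)
  refine ⟨fun u v => {p | ∃ r, N.IsRunOn (conv u (conv v o)) a b r ∧ r a = p.1 ∧ r b = p.2}, ?_⟩
  intro u₁ u₂ v₁ v₂ ht w₁ w₂ hacc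
  refine hacc.replace (w := conv u₁ (conv u₂ o)) (w' := conv v₁ (conv v₂ o)) hab ?_ ?_ ?_ ?_
  · intro l hl hl'
    simp [conv, patch_of_mem (hmem l hl hl')]
  · intro l hl hl'
    simp [conv, patch_of_mem (hmem l hl hl')]
  · intro l hl
    simp [conv, patch_of_notMem (hnmem l hl)]
  · intro p q hpq
    exact (Set.ext_iff.1 ht (p, q)).1 hpq

end LimitAutomaton

/-- The upper bound: a finite word oracle-automatic ordinal on an order of finite rank. -/
theorem IsFiniteWordOracleAutomaticOrdinal.lt {β : Ordinal.{u}} {m : ℕ}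
    (h : IsFiniteWordOracleAutomaticOrdinal L β)
    (hm : Finite (Quotient (condSetoid L m))) : β < ω ^ (ω ^ (m : Ordinal.{u})) := by
  obtain ⟨Γ, Ω, hΓ, hΩ, o, M, N, e, hinj, hran, hfin, hrel⟩ := h
  have := N.finite_Q
  have hR : IsWordPresentation e (fun w w' => N.Accepts (conv w (conv w' o))) := by
    refine ⟨hinj, fun w w' => ?_⟩
    have := Set.ext_iff.1 hrel (w, w')
    simpa using this
  have := hR.type_lt (blank := none) (fun x => hfin _ (Set.ext_iff.1 hran (e x) |>.1 ⟨x, rfl⟩))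
    (fun I hI => N.exists_isTypeMap o hI) hm
  rwa [type_toType] at this

end runs

/-! ### Tame automata -/

section tame

/-- A property of the elements of a complete linear order above `a` that passes to covers, through
limits from below, and to a neighbourhood above limits from above. -/
theorem CompleteLinearOrder.induction_ge {C : Type*} [CompleteLinearOrder C] {P : C → Prop} {a : C}
    (h0 : P a) (hs : ∀ x y, a ≤ x → x ⋖ y → P x → P y)
    (hl : ∀ c, a < c → (¬ ∃ d, d ⋖ c) → ∃ d < c, ∀ e, a ≤ e → d ≤ e → e < c → P e → P c)
    (hr : ∀ c, a ≤ c → c ≠ ⊤ → (¬ ∃ d, c ⋖ d) → P c → ∃ d > c, ∀ e, c ≤ e → e ≤ d → P e) :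
    ∀ c, a ≤ c → P c := by
  -- Induction along a continuum: the supremum of the points up to which `P` holds throughout
  -- satisfies `P`, and it can be passed unless it is `⊤`.
  let S : Set C := {c | a ≤ c ∧ ∀ e, a ≤ e → e ≤ c → P e}
  have haS : a ∈ S := ⟨le_rfl, fun e h h' => le_antisymm h h' ▸ h0⟩
  set s := sSup S with hsdef
  have has : a ≤ s := le_sSup haS
  have hlt : ∀ e, a ≤ e → e < s → P e := by
    intro e hae hes
    obtain ⟨c, hc, hec⟩ := lt_sSup_iff.1 hes
    exact hc.2 e hae hec.le
  have hPs : P s := by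
    rcases has.eq_or_lt with h | h
    · exact h ▸ h0
    by_cases hp : ∃ d, d ⋖ s
    · obtain ⟨d, hd⟩ := hp
      have had : a ≤ d := le_of_not_gt fun hda => hd.2 hda h
      exact hs d s had hd (hlt d had hd.1)
    · obtain ⟨d, hd, hP⟩ := hl s h hp
      exact hP (max a d) (le_max_left _ _) (le_max_right _ _) (max_lt h hd)
        (hlt _ (le_max_left _ _) (max_lt h hd))
  have hle : ∀ e, a ≤ e → e ≤ s → P e := fun e hae hes =>
    hes.eq_or_lt.elim (fun h => h ▸ hPs) (hlt e hae)
  have htop : s = ⊤ := by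
    by_contra hne
    by_cases hp : ∃ y, s ⋖ y
    · obtain ⟨y, hy⟩ := hp
      have hyS : y ∈ S := ⟨has.trans hy.1.le, fun e hae hey => by
        rcases hey.eq_or_lt with rfl | h
        · exact hs s e has hy hPs
        · exact hle e hae (le_of_not_gt fun hse => hy.2 hse h)⟩
      exact absurd (le_sSup hyS) (not_le.2 hy.1)
    · obtain ⟨d, hd, hP⟩ := hr s has hne hp hPs
      have hdS : d ∈ S := ⟨has.trans hd.le, fun e hae hed => by
        rcases le_total e s with h | h
        · exact hle e hae h
        · exact hP e h hed⟩
      exact absurd (le_sSup hdS) (not_le.2 hd)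
  intro c hc
  exact hle c hc (htop ▸ le_top)

/-- A map on a complete linear order that is constant near every limit. -/
structure Tame {C : Type*} [CompleteLinearOrder C] {Q : Type*} (r : C → Q) : Prop where
  below : ∀ c, c ≠ ⊥ → (¬ ∃ d, d ⋖ c) → ∃ d < c, ∀ e, d ≤ e → e ≤ c → r e = r c
  above : ∀ c, c ≠ ⊤ → (¬ ∃ d, c ⋖ d) → ∃ d > c, ∀ e, c ≤ e → e ≤ d → r e = r c

namespace Tame

variable {C : Type*} [CompleteLinearOrder C] {Q Q' : Type*} {r : C → Q} {r' : C → Q'}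

theorem comp (h : Tame r) (f : Q → Q') : Tame fun c => f (r c) := by
  refine ⟨fun c hc hn => ?_, fun c hc hn => ?_⟩
  · obtain ⟨d, hd, h⟩ := h.below c hc hn
    exact ⟨d, hd, fun e he he' => congrArg f (h e he he')⟩
  · obtain ⟨d, hd, h⟩ := h.above c hc hn
    exact ⟨d, hd, fun e he he' => congrArg f (h e he he')⟩

theorem prodMk (h : Tame r) (h' : Tame r') : Tame fun c => (r c, r' c) := by
  refine ⟨fun c hc hn => ?_, fun c hc hn => ?_⟩
  · obtain ⟨d, hd, h⟩ := h.below c hc hn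
    obtain ⟨d', hd', h'⟩ := h'.below c hc hn
    exact ⟨max d d', max_lt hd hd', fun e he he' =>
      Prod.ext (h e ((le_max_left _ _).trans he) he') (h' e ((le_max_right _ _).trans he) he')⟩
  · obtain ⟨d, hd, h⟩ := h.above c hc hn
    obtain ⟨d', hd', h'⟩ := h'.above c hc hn
    exact ⟨min d d', lt_min hd hd', fun e he he' =>
      Prod.ext (h e he (he'.trans (min_le_left _ _))) (h' e he (he'.trans (min_le_right _ _)))⟩

theorem const (q : Q) : Tame fun _ : C => q := by
  refine ⟨fun c hc _ => ⟨⊥, bot_lt_iff_ne_bot.2 hc, fun _ _ _ => rfl⟩,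
    fun c hc _ => ⟨⊤, lt_top_iff_ne_top.2 hc, fun _ _ _ => rfl⟩⟩

theorem dual (h : Tame r) : Tame fun c : Cᵒᵈ => r (OrderDual.ofDual c) := by
  refine ⟨fun c hc hn => ?_, fun c hc hn => ?_⟩
  · obtain ⟨d, hd, h⟩ := h.above (OrderDual.ofDual c) hc fun ⟨d, hd⟩ => hn ⟨_, hd.toDual⟩
    exact ⟨OrderDual.toDual d, hd, fun e he he' => h _ he' he⟩
  · obtain ⟨d, hd, h⟩ := h.below (OrderDual.ofDual c) hc fun ⟨d, hd⟩ => hn ⟨_, hd.toDual⟩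
    exact ⟨OrderDual.toDual d, hd, fun e he he' => h _ he' he⟩

/-- A tame map cannot change at a limit, so invariants need checking only across consecutive points.
This makes tame runs as tractable as runs on finite words. -/
theorem induction_ge (h : Tame r) {p : Q → Prop} {a : C} (h0 : p (r a))
    (hs : ∀ x y, a ≤ x → x ⋖ y → p (r x) → p (r y)) : ∀ c, a ≤ c → p (r c) := by
  refine CompleteLinearOrder.induction_ge h0 hs (fun c hc hn => ?_) (fun c _ hc' hn hp => ?_)
  · obtain ⟨d, hd, h⟩ := h.below c (ne_bot_of_gt hc) hn
    exact ⟨d, hd, fun e _ he he' hp => h e he he'.le ▸ hp⟩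
  · obtain ⟨d, hd, h⟩ := h.above c hc' hn
    exact ⟨d, hd, fun e he he' => (h e he he').symm ▸ hp⟩

theorem induction_le (h : Tame r) {p : Q → Prop} {a : C} (h0 : p (r a))
    (hs : ∀ x y, y ≤ a → x ⋖ y → p (r y) → p (r x)) : ∀ c, c ≤ a → p (r c) := by
  intro c hc
  exact h.dual.induction_ge (p := p) (a := OrderDual.toDual a) h0
    (fun x y hx hxy hp => hs _ _ hx hxy.ofDual hp) (OrderDual.toDual c) hc

/-- A tame map jumps finitely often. -/
theorem finite_jumps (h : Tame r) : {y | ∃ x, x ⋖ y ∧ r x ≠ r y}.Finite := by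
  -- Constancy near a limit means that crossing it adds no jump, so the number of jumps stays
  -- finite.
  have key : ∀ c : C, ⊥ ≤ c → {y | y ≤ c ∧ ∃ x, x ⋖ y ∧ r x ≠ r y}.Finite := by
    refine CompleteLinearOrder.induction_ge ?_ ?_ ?_ ?_
    · refine (Set.finite_singleton ⊥).subset fun y hy => le_bot_iff.1 hy.1
    · intro x y _ hxy hx
      refine (hx.insert y).subset fun z hz => ?_
      rcases hz.1.eq_or_lt with h | h
      · exact Or.inl h
      · exact Or.inr ⟨le_of_not_gt fun hxz => hxy.2 hxz h, hz.2⟩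
    · intro c hc hn
      obtain ⟨d, hd, hconst⟩ := h.below c hc.ne' hn
      refine ⟨d, hd, fun e _ hde hec he => he.subset ?_⟩
      rintro z ⟨hzc, x, hxz, hne⟩
      refine ⟨le_of_not_gt fun hez => hne ?_, x, hxz, hne⟩
      have hdx : d ≤ x := hde.trans (le_of_not_gt fun hxe => hxz.2 hxe hez)
      rw [hconst x hdx (hxz.1.le.trans hzc), hconst z (hdx.trans hxz.1.le) hzc]
    · intro c _ hc hn hfin
      obtain ⟨d, hd, hconst⟩ := h.above c hc hn
      refine ⟨d, hd, fun e hce hed => hfin.subset ?_⟩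
      rintro z ⟨hze, x, hxz, hne⟩
      refine ⟨le_of_not_gt fun hcz => hne ?_, x, hxz, hne⟩
      have hcx : c ≤ x := le_of_not_gt fun hxc => hxz.2 hxc hcz
      rw [hconst x hcx ((hxz.1.le.trans hze).trans hed),
        hconst z (hcx.trans hxz.1.le) (hze.trans hed)]
  simpa using key ⊤ bot_le

end Tame

variable {L : Type u} [LinearOrder L] {A : Type}

/-! ### Recognition by tame runs. -/

theorem Cut.lt_of_notMem_of_mem {a b : Cut L} {l : L} (ha : l ∉ a) (hb : l ∈ b) : a < b :=
  lt_of_not_ge fun h => ha (h hb)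

theorem Cut.Iio_covBy_Iic (l : L) : (LowerSet.Iio l : Cut L) ⋖ LowerSet.Iic l := by
  refine ⟨Cut.lt_of_notMem_of_mem (l := l) (by simp) (by simp), fun z hz hz' => ?_⟩
  refine absurd hz' (not_lt.2 (Cut.Iic_le_of_mem ?_))
  by_contra hl
  exact absurd (Cut.le_Iio_of_notMem hl) (not_le.2 hz)

theorem Cut.covBy_iff {x y : Cut L} : x ⋖ y ↔ ∃ l, x = LowerSet.Iio l ∧ y = LowerSet.Iic l := by
  constructor
  · intro h
    obtain ⟨l, hly, hlx⟩ : ∃ l ∈ y, l ∉ x := by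
      by_contra! hcon
      exact absurd h.1 (not_lt.2 fun l hl => hcon l hl)
    have h1 := Cut.le_Iio_of_notMem hlx
    have h2 := Cut.Iic_le_of_mem hly
    have h3 := (Cut.Iio_covBy_Iic l).1
    exact ⟨l, le_antisymm h1 (le_of_not_gt fun h' => h.2 h' (h3.trans_le h2)),
      le_antisymm (le_of_not_gt fun h' => h.2 (h1.trans_lt h3) h') h2⟩
  · rintro ⟨l, rfl, rfl⟩
    exact Cut.Iio_covBy_Iic l

/-- A set of words is tamely recognizable if it is recognized by an automaton all of whose limit
transitions stay in a state. -/
def IsTamelyRecognizable (X : Set (L → A)) : Prop :=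
  ∃ (Q : Type) (_ : Finite Q) (T : Set (Q × A × Q)) (i f : Set Q), ∀ w, w ∈ X ↔
    ∃ r : Cut L → Q, Tame r ∧ (∀ l, (r (LowerSet.Iio l), w l, r (LowerSet.Iic l)) ∈ T) ∧
      r ⊥ ∈ i ∧ r ⊤ ∈ f

/-- Each state other than `q` is avoided from some threshold on; as there are finitely many states,
the greatest threshold works for all. -/
theorem limBelow_eq_singleton_iff {Q : Type} [Finite Q] {r : Cut L → Q} {c : Cut L} (hc : c ≠ ⊥)
    {q : Q} :
    limBelow r c = {q} ↔ ∃ d < c, ∀ e, d ≤ e → e < c → r e = q := by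
  constructor
  · intro h
    have hd : ∀ q', ∃ d < c, q' ≠ q → ∀ e, d ≤ e → e < c → r e ≠ q' := by
      intro q'
      by_cases hq : q' = q
      · exact ⟨⊥, bot_lt_iff_ne_bot.2 hc, fun h => absurd hq h⟩
      · have : q' ∉ limBelow r c := by rw [h]; exact hq
        simp only [limBelow, Set.mem_ofPred_eq, not_forall, not_exists, not_and] at this
        obtain ⟨d, hd, h⟩ := this
        exact ⟨d, hd, fun _ => h⟩
    choose d hd hd' using hd
    have : Nonempty Q := ⟨q⟩
    obtain ⟨q₀, hq₀⟩ := Finite.exists_max d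
    refine ⟨d q₀, hd q₀, fun e he hec => ?_⟩
    by_contra hne
    exact hd' (r e) hne e ((hq₀ _).trans he) hec rfl
  · rintro ⟨d, hd, h⟩
    ext q'
    constructor
    · intro hq'
      obtain ⟨e, he, hec, rfl⟩ := hq' d hd
      exact h e he hec
    · rintro rfl d' hd'
      exact ⟨max d d', le_max_right _ _, max_lt hd hd', h _ (le_max_left _ _) (max_lt hd hd')⟩

theorem limAbove_eq_singleton_iff {Q : Type} [Finite Q] {r : Cut L → Q} {c : Cut L} (hc : c ≠ ⊤)
    {q : Q} :
    limAbove r c = {q} ↔ ∃ d > c, ∀ e, c < e → e ≤ d → r e = q := by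
  constructor
  · intro h
    have hd : ∀ q', ∃ d > c, q' ≠ q → ∀ e, c < e → e ≤ d → r e ≠ q' := by
      intro q'
      by_cases hq : q' = q
      · exact ⟨⊤, lt_top_iff_ne_top.2 hc, fun h => absurd hq h⟩
      · have : q' ∉ limAbove r c := by rw [h]; exact hq
        simp only [limAbove, Set.mem_ofPred_eq, not_forall, not_exists, not_and] at this
        obtain ⟨d, hd, h⟩ := this
        exact ⟨d, hd, fun _ => h⟩
    choose d hd hd' using hd
    have : Nonempty Q := ⟨q⟩
    obtain ⟨q₀, hq₀⟩ := Finite.exists_min d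
    refine ⟨d q₀, hd q₀, fun e he hec => ?_⟩
    by_contra hne
    exact hd' (r e) hne e he (hec.trans (hq₀ _)) rfl
  · rintro ⟨d, hd, h⟩
    ext q'
    constructor
    · intro hq'
      obtain ⟨e, he, hec, rfl⟩ := hq' d hd
      exact h e he hec
    · rintro rfl d' hd'
      exact ⟨min d d', lt_min hd hd', min_le_right _ _, h _ (lt_min hd hd') (min_le_left _ _)⟩

namespace IsTamelyRecognizable

variable {X Y : Set (L → A)}

/-- Allowing only the limit transitions `({q}, q)` and `(q, {q})` forces exactly the tame runs. -/
theorem exists_limitAutomaton (hX : IsTamelyRecognizable X) :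
    ∃ M : LimitAutomaton A, ∀ w, M.Accepts w ↔ w ∈ X := by
  obtain ⟨Q, hQ, T, i, f, h⟩ := hX
  refine ⟨⟨Q, hQ, i, f, T, {p | p.1 = {p.2}}, {p | p.2 = {p.1}}⟩, fun w => ?_⟩
  rw [h]
  refine exists_congr fun r => ?_
  constructor
  · rintro ⟨hr, h1, h2⟩
    refine ⟨⟨fun c hc hn => ?_, fun c hc hn => ?_⟩, hr.succ, h1, h2⟩
    · obtain ⟨d, hd, h⟩ := (limBelow_eq_singleton_iff hc).1 (hr.right c hc hn)
      exact ⟨d, hd, fun e he hec => hec.eq_or_lt.elim (fun h => h ▸ rfl) (h e he)⟩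
    · obtain ⟨d, hd, h⟩ := (limAbove_eq_singleton_iff hc).1 (hr.left c hc hn)
      exact ⟨d, hd, fun e he hec => he.eq_or_lt.elim (fun h => h ▸ rfl) fun he => h e he hec⟩
  · rintro ⟨hr, hs, h1, h2⟩
    refine ⟨⟨hs, fun c hc hn => ?_, fun c hc hn => ?_⟩, h1, h2⟩
    · obtain ⟨d, hd, h⟩ := hr.below c hc hn
      exact (limBelow_eq_singleton_iff hc).2 ⟨d, hd, fun e he hec => h e he hec.le⟩
    · obtain ⟨d, hd, h⟩ := hr.above c hc hn
      exact (limAbove_eq_singleton_iff hc).2 ⟨d, hd, fun e he hec => h e he.le hec⟩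

theorem inter (hX : IsTamelyRecognizable X) (hY : IsTamelyRecognizable Y) :
    IsTamelyRecognizable (X ∩ Y) := by
  obtain ⟨Q, hQ, T, i, f, h⟩ := hX
  obtain ⟨Q', hQ', T', i', f', h'⟩ := hY
  refine ⟨Q × Q', inferInstance, {t | (t.1.1, t.2.1, t.2.2.1) ∈ T ∧ (t.1.2, t.2.1, t.2.2.2) ∈ T'},
    i ×ˢ i', f ×ˢ f', fun w => ?_⟩
  rw [Set.mem_inter_iff, h, h']
  constructor
  · rintro ⟨⟨r, hr, hs, h1, h2⟩, r', hr', hs', h1', h2'⟩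
    exact ⟨_, hr.prodMk hr', fun l => ⟨hs l, hs' l⟩, ⟨h1, h1'⟩, ⟨h2, h2'⟩⟩
  · rintro ⟨r, hr, hs, h1, h2⟩
    exact ⟨⟨_, hr.comp Prod.fst, fun l => (hs l).1, h1.1, h2.1⟩,
      ⟨_, hr.comp Prod.snd, fun l => (hs l).2, h1.2, h2.2⟩⟩

/-- The disjoint sum of the automata: a tame run that starts in one summand never leaves it, since
no transition crosses over. -/
theorem union (hX : IsTamelyRecognizable X) (hY : IsTamelyRecognizable Y) :
    IsTamelyRecognizable (X ∪ Y) := by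
  obtain ⟨Q, hQ, T, i, f, h⟩ := hX
  obtain ⟨Q', hQ', T', i', f', h'⟩ := hY
  let U : Set ((Q ⊕ Q') × A × (Q ⊕ Q')) := {t | (∃ p q, t.1 = .inl p ∧ t.2.2 = .inl q ∧
    (p, t.2.1, q) ∈ T) ∨ ∃ p q, t.1 = .inr p ∧ t.2.2 = .inr q ∧ (p, t.2.1, q) ∈ T'}
  refine ⟨Q ⊕ Q', inferInstance, U, Sum.inl '' i ∪ Sum.inr '' i', Sum.inl '' f ∪ Sum.inr '' f',
    fun w => ?_⟩
  rw [Set.mem_union, h, h']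
  constructor
  · rintro (⟨r, hr, hs, h1, h2⟩ | ⟨r, hr, hs, h1, h2⟩)
    · exact ⟨_, hr.comp Sum.inl, fun l => Or.inl ⟨_, _, rfl, rfl, hs l⟩,
        Or.inl ⟨_, h1, rfl⟩, Or.inl ⟨_, h2, rfl⟩⟩
    · exact ⟨_, hr.comp Sum.inr, fun l => Or.inr ⟨_, _, rfl, rfl, hs l⟩,
        Or.inr ⟨_, h1, rfl⟩, Or.inr ⟨_, h2, rfl⟩⟩
  · rintro ⟨r, hr, hs, h1, h2⟩
    rcases h1 with ⟨q₀, hq₀, h1⟩ | ⟨q₀, hq₀, h1⟩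
    · left
      have hl : ∀ c, ∃ q, r c = .inl q := fun c => by
        refine hr.induction_ge (p := fun s => ∃ q, s = .inl q) ⟨q₀, h1.symm⟩ ?_ c bot_le
        rintro x y - hxy ⟨q, hq⟩
        obtain ⟨l, rfl, rfl⟩ := Cut.covBy_iff.1 hxy
        rcases hs l with ⟨p, q', -, h, -⟩ | ⟨p, q', h, -, -⟩
        · exact ⟨q', h⟩
        · rw [hq] at h; simp at h
      choose s hs' using hl
      have hrs : ∀ c, (r c).elim id (fun _ => q₀) = s c := fun c => by rw [hs' c]; rfl
      refine ⟨s, ?_, fun l => ?_, ?_, ?_⟩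
      · simpa only [hrs] using hr.comp fun t => t.elim id (fun _ => q₀)
      · rcases hs l with ⟨p, q', h1, h2, h3⟩ | ⟨p, q', h, -, -⟩
        · simp only [hs', Sum.inl.injEq] at h1 h2
          rw [h1, h2]; exact h3
        · simp [hs'] at h
      · simp only [hs', Sum.inl.injEq] at h1
        rwa [← h1]
      · rw [hs'] at h2
        simpa using h2
    · right
      have hl : ∀ c, ∃ q, r c = .inr q := fun c => by
        refine hr.induction_ge (p := fun s => ∃ q, s = .inr q) ⟨q₀, h1.symm⟩ ?_ c bot_le
        rintro x y - hxy ⟨q, hq⟩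
        obtain ⟨l, rfl, rfl⟩ := Cut.covBy_iff.1 hxy
        rcases hs l with ⟨p, q', h, -, -⟩ | ⟨p, q', -, h, -⟩
        · rw [hq] at h; simp at h
        · exact ⟨q', h⟩
      choose s hs' using hl
      have hrs : ∀ c, (r c).elim (fun _ => q₀) id = s c := fun c => by rw [hs' c]; rfl
      refine ⟨s, ?_, fun l => ?_, ?_, ?_⟩
      · simpa only [hrs] using hr.comp fun t => t.elim (fun _ => q₀) id
      · rcases hs l with ⟨p, q', h, -, -⟩ | ⟨p, q', h1, h2, h3⟩
        · simp [hs'] at h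
        · simp only [hs', Sum.inr.injEq] at h1 h2
          rw [h1, h2]; exact h3
      · simp only [hs', Sum.inr.injEq] at h1
        rwa [← h1]
      · rw [hs'] at h2
        simpa using h2

theorem comap {B : Type} (hX : IsTamelyRecognizable X) (g : B → A) :
    IsTamelyRecognizable {w : L → B | (fun l => g (w l)) ∈ X} := by
  obtain ⟨Q, hQ, T, i, f, h⟩ := hX
  exact ⟨Q, hQ, {t | (t.1, g t.2.1, t.2.2) ∈ T}, i, f, fun w => h _⟩

theorem letters (S : Set A) : IsTamelyRecognizable {w : L → A | ∀ l, w l ∈ S} := by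
  refine ⟨Unit, inferInstance, {t | t.2.1 ∈ S}, Set.univ, Set.univ, fun w => ?_⟩
  exact ⟨fun h => ⟨_, Tame.const (), h, trivial, trivial⟩, fun ⟨r, _, h, _⟩ => h⟩

/-- The state flips exactly at letters in `S`. Tame maps jump finitely often, which gives one
direction; the parity of the number of such letters seen so far is a tame run for the other. -/
theorem finite (S : Set A) : IsTamelyRecognizable {w : L → A | {l | w l ∈ S}.Finite} := by
  classical
  refine ⟨Prop, inferInstance, {t | (t.1 ↔ t.2.2) ↔ t.2.1 ∉ S}, Set.univ, Set.univ, fun w => ?_⟩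
  constructor
  · intro hfin
    let F : Cut L → Set L := fun c => {l | w l ∈ S} ∩ {l | l ∈ c}
    refine ⟨fun c => Even (F c).ncard, ⟨fun c hc hn => ?_, fun c hc hn => ?_⟩, fun l => ?_,
      trivial, trivial⟩
    · obtain ⟨d, hd, hF⟩ : ∃ d < c, F c ⊆ {l | l ∈ d} := by
        rcases (F c).eq_empty_or_nonempty with h0 | hne
        · exact ⟨⊥, bot_lt_iff_ne_bot.2 hc, by simp [h0]⟩
        · obtain ⟨b, hb, hmax⟩ := Set.exists_max_image (F c) id (hfin.inter_of_left _) hne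
          refine ⟨LowerSet.Iic b, (Cut.Iic_le_of_mem hb.2).lt_of_ne ?_,
            fun l hl => LowerSet.mem_Iic_iff.2 (hmax l hl)⟩
          rintro rfl
          exact hn ⟨_, Cut.Iio_covBy_Iic b⟩
      refine ⟨d, hd, fun e he hec => ?_⟩
      have : F e = F c := Set.Subset.antisymm (fun l hl => ⟨hl.1, hec hl.2⟩)
        fun l hl => ⟨hl.1, he (hF hl)⟩
      rw [this]
    · obtain ⟨d, hd, hF⟩ : ∃ d > c, ∀ l ∈ d, w l ∈ S → l ∈ c := by
        rcases ({l | w l ∈ S} ∩ {l | l ∉ c}).eq_empty_or_nonempty with h0 | hne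
        · refine ⟨⊤, lt_top_iff_ne_top.2 hc, fun l _ hl => ?_⟩
          by_contra hlc
          have : l ∈ {l | w l ∈ S} ∩ {l | l ∉ c} := ⟨hl, hlc⟩
          rw [h0] at this
          exact this
        · obtain ⟨b, hb, hmin⟩ := Set.exists_min_image _ id (hfin.inter_of_left _) hne
          refine ⟨LowerSet.Iio b, lt_of_le_of_ne (Cut.le_Iio_of_notMem hb.2) ?_, fun l hl hw => ?_⟩
          · rintro rfl
            exact hn ⟨_, Cut.Iio_covBy_Iic b⟩
          · by_contra hlc
            exact absurd (LowerSet.mem_Iio_iff.1 hl) (not_lt.2 (hmin l ⟨hw, hlc⟩))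
      refine ⟨d, hd, fun e he hed => ?_⟩
      have : F e = F c := Set.Subset.antisymm (fun l hl => ⟨hl.1, hF l (hed hl.2) hl.1⟩)
        fun l hl => ⟨hl.1, he hl.2⟩
      rw [this]
    · by_cases hl : w l ∈ S
      · have : F (LowerSet.Iic l) = insert l (F (LowerSet.Iio l)) := by
          ext x
          simp only [F, Set.mem_inter_iff, Set.mem_ofPred_eq, LowerSet.mem_Iic_iff,
            LowerSet.mem_Iio_iff, Set.mem_insert_iff, le_iff_eq_or_lt]
          constructor
          · rintro ⟨h1, h2⟩
            tauto
          · rintro (rfl | h)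
            · exact ⟨hl, Or.inl rfl⟩
            · tauto
        have hcard : (F (LowerSet.Iic l)).ncard = (F (LowerSet.Iio l)).ncard + 1 := by
          rw [this]
          exact Set.ncard_insert_of_notMem (by simp [F]) (hfin.inter_of_left _)
        simp only [Set.mem_ofPred_eq, hl, hcard, Nat.even_add_one]
        tauto
      · have : F (LowerSet.Iic l) = F (LowerSet.Iio l) := by
          ext x
          simp only [F, Set.mem_inter_iff, Set.mem_ofPred_eq, LowerSet.mem_Iic_iff,
            LowerSet.mem_Iio_iff, le_iff_eq_or_lt]
          constructor
          · rintro ⟨h1, rfl | h2⟩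
            · exact absurd h1 hl
            · exact ⟨h1, h2⟩
          · tauto
        simp [hl, this]
  · rintro ⟨r, hr, hs, -⟩
    refine Set.Finite.of_injOn (f := fun l => (LowerSet.Iic l : Cut L)) ?_ ?_ hr.finite_jumps
    · intro l hl
      refine ⟨_, Cut.Iio_covBy_Iic l, fun h => ?_⟩
      have := hs l
      simp only [Set.mem_ofPred_eq, h] at this hl
      tauto
    · intro x _ y _ hxy
      exact LowerSet.Iic_injective hxy

end IsTamelyRecognizable

end tame

/-! ### Ranked orders -/

section ranked

set_option linter.unusedSectionVars false

variable {L : Type u} [LinearOrder L] {N : ℕ}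

/-- The greatest rank that occurs in a set. -/
noncomputable def maxRank (rk : L → Fin (N + 1)) (X : Set L) : Fin (N + 1) := ⨆ l ∈ X, rk l

theorem maxRank_le_iff {rk : L → Fin (N + 1)} {X : Set L} {n : Fin (N + 1)} :
    maxRank rk X ≤ n ↔ ∀ l ∈ X, rk l ≤ n := iSup₂_le_iff

theorem maxRank_congr {rk rk' : L → Fin (N + 1)} {X : Set L} (h : ∀ l ∈ X, rk l = rk' l) :
    maxRank rk X = maxRank rk' X :=
  iSup_congr fun l => iSup_congr fun hl => h l hl

theorem maxRank_insert {rk : L → Fin (N + 1)} {X : Set L} {l : L} :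
    maxRank rk (insert l X) = max (rk l) (maxRank rk X) := iSup_insert

theorem maxRank_eq_of_mem {rk : L → Fin (N + 1)} {X : Set L} {l : L} (hl : l ∈ X)
    (h : ∀ x, rk x ≤ rk l) : maxRank rk X = rk l :=
  le_antisymm (maxRank_le_iff.2 fun x _ => h x) (maxRank_le_iff.1 le_rfl l hl)

theorem maxRank_empty {rk : L → Fin (N + 1)} : maxRank rk ∅ = 0 := by
  refine le_antisymm (maxRank_le_iff.2 fun x hx => absurd hx (Set.notMem_empty x)) (Fin.zero_le _)

/-- `p` comes before `q` with respect to `rk`: the greatest rank between them is odd if `p < q`, and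
even if `q < p`. -/
def rankLT (rk : L → Fin (N + 1)) (p q : L) : Prop :=
  (p < q ∧ Odd (maxRank rk (Set.Ioo p q) : ℕ)) ∨ (q < p ∧ Even (maxRank rk (Set.Ioo q p) : ℕ))

open Classical in
/-- The side of `p` on which a cut lies and the greatest rank between the cut and `p`. -/
noncomputable def rankRun (rk : L → Fin (N + 1)) (p : L) (c : Cut L) : Bool × Fin (N + 1) :=
  if p ∈ c then (true, maxRank rk {l | l ∈ c ∧ p < l}) else (false, maxRank rk {l | l ∉ c ∧ l < p})

theorem rankRun_of_mem {rk : L → Fin (N + 1)} {p : L} {c : Cut L} (h : p ∈ c) :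
    rankRun rk p c = (true, maxRank rk {l | l ∈ c ∧ p < l}) := if_pos h

theorem rankRun_of_notMem {rk : L → Fin (N + 1)} {p : L} {c : Cut L} (h : p ∉ c) :
    rankRun rk p c = (false, maxRank rk {l | l ∉ c ∧ l < p}) := if_neg h

theorem rankRun_Iio_of_lt {rk : L → Fin (N + 1)} {p l : L} (h : p < l) :
    rankRun rk p (LowerSet.Iio l) = (true, maxRank rk (Set.Ioo p l)) := by
  rw [rankRun_of_mem (LowerSet.mem_Iio_iff.2 h)]
  congr 2
  ext x
  simp [and_comm]

theorem rankRun_Iic_of_lt {rk : L → Fin (N + 1)} {p l : L} (h : p < l) :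
    rankRun rk p (LowerSet.Iic l) = (true, max (rk l) (maxRank rk (Set.Ioo p l))) := by
  rw [rankRun_of_mem (LowerSet.mem_Iic_iff.2 h.le), ← maxRank_insert]
  congr 2
  ext x
  simp only [LowerSet.mem_Iic_iff, Set.mem_ofPred_eq, Set.mem_insert_iff, Set.mem_Ioo, le_iff_eq_or_lt]
  constructor
  · rintro ⟨h1 | h1, h2⟩
    · exact Or.inl h1
    · exact Or.inr ⟨h2, h1⟩
  · rintro (rfl | h1)
    · exact ⟨Or.inl rfl, h⟩
    · exact ⟨Or.inr h1.2, h1.1⟩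

theorem rankRun_Iic_of_gt {rk : L → Fin (N + 1)} {p l : L} (h : l < p) :
    rankRun rk p (LowerSet.Iic l) = (false, maxRank rk (Set.Ioo l p)) := by
  rw [rankRun_of_notMem (by simpa using h)]
  congr 2
  ext x
  simp

theorem rankRun_Iio_of_gt {rk : L → Fin (N + 1)} {p l : L} (h : l < p) :
    rankRun rk p (LowerSet.Iio l) = (false, max (rk l) (maxRank rk (Set.Ioo l p))) := by
  rw [rankRun_of_notMem (by simpa using h.le), ← maxRank_insert]
  congr 2
  ext x
  simp only [LowerSet.mem_Iio_iff, Set.mem_ofPred_eq, Set.mem_insert_iff, Set.mem_Ioo, not_lt,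
    le_iff_eq_or_lt]
  constructor
  · rintro ⟨h1 | h1, h2⟩
    · exact Or.inl h1.symm
    · exact Or.inr ⟨h1, h2⟩
  · rintro (rfl | h1)
    · exact ⟨Or.inl rfl, h⟩
    · exact ⟨Or.inr h1.1, h1.2⟩

theorem rankRun_Iio_self {rk : L → Fin (N + 1)} {p : L} :
    rankRun rk p (LowerSet.Iio p) = (false, 0) := by
  rw [rankRun_of_notMem (by simp), ← maxRank_empty (rk := rk)]
  congr 2
  ext x
  simp

theorem rankRun_Iic_self {rk : L → Fin (N + 1)} {p : L} :
    rankRun rk p (LowerSet.Iic p) = (true, 0) := by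
  rw [rankRun_of_mem (by simp), ← maxRank_empty (rk := rk)]
  congr 2
  ext x
  simp

/-- The track `i` belongs to the letter `g`. -/
def inLetter {k : ℕ} (g : Option (Set (Fin k))) (i : Fin k) : Prop := ∃ B, g = some B ∧ i ∈ B

/-- The letters agree on all tracks above `i`. -/
def agreeAbove {k : ℕ} (g h : Option (Set (Fin k))) (i : Fin k) : Prop :=
  ∀ j, i < j → (inLetter g j ↔ inLetter h j)

/-- At the greatest place (with respect to tracks, then to `rk`) where the tracks of `w` and `v`
differ on `P`, the element belongs to `v`. -/
def trackLT {k : ℕ} (P : Set L) (rk : L → Fin (N + 1)) (w v : L → Option (Set (Fin k))) : Prop :=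
  ∃ i : Fin k, ∃ p ∈ P, ¬ inLetter (w p) i ∧ inLetter (v p) i ∧ (∀ l, agreeAbove (w l) (v l) i) ∧
    ∀ q ∈ P, rankLT rk p q → (inLetter (w q) i ↔ inLetter (v q) i)

/-- The transitions of the automaton that recognizes `trackLT`. -/
def trackTrans (k N : ℕ) : Set ((Fin k × Bool × Fin (N + 1)) ×
    (Option (Set (Fin k)) × Option (Set (Fin k)) × Prop × Fin (N + 1)) ×
    (Fin k × Bool × Fin (N + 1))) :=
  {t | ∃ i K w v P ρ K', agreeAbove w v i ∧
    -- `K` is meant to be the greatest rank between the cut and the guessed point, so before that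
    -- point it is determined from right to left. The value on the inner side of a letter is the
    -- rank strictly between, hence the test for even `K'` here and for odd `K` in the last case.
    ((t = ((i, false, K), (w, v, P, ρ), (i, false, K')) ∧ K = max ρ K' ∧
        (P → Even (K' : ℕ) → (inLetter w i ↔ inLetter v i))) ∨
      (t = ((i, false, 0), (w, v, P, ρ), (i, true, 0)) ∧ P ∧ ¬ inLetter w i ∧ inLetter v i) ∨
      (t = ((i, true, K), (w, v, P, ρ), (i, true, K')) ∧ K' = max ρ K ∧
        (P → Odd (K : ℕ) → (inLetter w i ↔ inLetter v i))))}

/-- The automaton guesses the track `i` and the point `p`. Tameness of `rankRun rk p` supplies an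
accepting run, and conversely forces every accepting run to agree with it. Membership in `P` and the
ranks are letters because they will come from the oracle. -/
theorem isTamelyRecognizable_trackLT (k : ℕ) (P : Set L) (rk : L → Fin (N + 1))
    (htame : ∀ p ∈ P, Tame (rankRun rk p)) :
    ∃ X : Set (L → Option (Set (Fin k)) × Option (Set (Fin k)) × Prop × Fin (N + 1)),
      IsTamelyRecognizable X ∧
      ∀ w v, (fun l => (w l, v l, l ∈ P, rk l)) ∈ X ↔ trackLT P rk w v := by
  refine ⟨{w | ∃ r : Cut L → Fin k × Bool × Fin (N + 1), Tame r ∧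
    (∀ l, (r (LowerSet.Iio l), w l, r (LowerSet.Iic l)) ∈ trackTrans k N) ∧
      r ⊥ ∈ {q | q.2.1 = false} ∧ r ⊤ ∈ {q | q.2.1 = true}},
    ⟨_, inferInstance, trackTrans k N, _, _, fun w => Iff.rfl⟩, fun w v => ?_⟩
  constructor
  · rintro ⟨r, hr, hs, hi, hf⟩
    simp only [Set.mem_ofPred_eq] at hi hf
    -- The side goes from `false` to `true`, and a tame run can change it only at a letter.
    obtain ⟨p, hp1, hp2⟩ : ∃ p, (r (LowerSet.Iio p)).2.1 = false ∧
        (r (LowerSet.Iic p)).2.1 = true := by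
      by_contra! hcon
      have := hr.induction_ge (p := fun q => q.2.1 = false) hi (fun x y _ hxy hx => by
        obtain ⟨l, rfl, rfl⟩ := Cut.covBy_iff.1 hxy
        simpa using hcon l hx) ⊤ bot_le
      rw [hf] at this
      cases this
    obtain ⟨i, _, w', v', P', ρ, _, hag, h | h | h⟩ := hs p
    · have := h.1
      simp only [Prod.mk.injEq] at this
      rw [this.2.2] at hp2
      cases hp2
    swap
    · have := h.1
      simp only [Prod.mk.injEq] at this
      rw [this.1] at hp1
      cases hp1
    obtain ⟨he, hP, hw, hv⟩ := h
    simp only [Prod.mk.injEq] at he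
    obtain ⟨hr1, ⟨rfl, rfl, rfl, rfl⟩, hr2⟩ := he
    -- Away from `p` the transitions are deterministic in the outward direction, and both the run
    -- and `rankRun` are tame, so they coincide.
    have hup : ∀ c, LowerSet.Iic p ≤ c → r c = (i, rankRun rk p c) := by
      have := (hr.prodMk (htame p hP)).induction_ge (p := fun q => q.1 = (i, q.2))
        (a := LowerSet.Iic p) (by rw [hr2, rankRun_Iic_self]) (fun x y hx hxy hx' => by
          obtain ⟨l, rfl, rfl⟩ := Cut.covBy_iff.1 hxy
          have hpl : p < l := LowerSet.mem_Iio_iff.1 (hx (LowerSet.mem_Iic_iff.2 le_rfl))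
          simp only [rankRun_Iio_of_lt hpl] at hx'
          simp only [rankRun_Iic_of_lt hpl]
          obtain ⟨i', K, _, _, _, _, K', -, h | h | h⟩ := hs l
          all_goals
            have he := h.1
            simp only [Prod.mk.injEq] at he
            rw [hx'] at he
          · simp at he
          · simp at he
          · obtain ⟨h1, ⟨-, -, -, rfl⟩, h2⟩ := he
            simp only [Prod.mk.injEq] at h1
            obtain ⟨rfl, -, rfl⟩ := h1
            rw [h2, h.2.1])
      exact this
    have hdown : ∀ c, c ≤ LowerSet.Iio p → r c = (i, rankRun rk p c) := by
      have := (hr.prodMk (htame p hP)).induction_le (p := fun q => q.1 = (i, q.2))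
        (a := LowerSet.Iio p) (by rw [hr1, rankRun_Iio_self]) (fun x y hx hxy hx' => by
          obtain ⟨l, rfl, rfl⟩ := Cut.covBy_iff.1 hxy
          have hpl : l < p := LowerSet.mem_Iio_iff.1 (hx (LowerSet.mem_Iic_iff.2 le_rfl))
          simp only [rankRun_Iic_of_gt hpl] at hx'
          simp only [rankRun_Iio_of_gt hpl]
          obtain ⟨i', K, _, _, _, _, K', -, h | h | h⟩ := hs l
          all_goals
            have he := h.1
            simp only [Prod.mk.injEq] at he
            rw [hx'] at he
          · obtain ⟨h1, ⟨-, -, -, rfl⟩, h2⟩ := he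
            simp only [Prod.mk.injEq] at h2
            obtain ⟨rfl, -, rfl⟩ := h2
            rw [h1, h.2.1]
          · simp at he
          · simp at he)
      exact this
    have hi' : ∀ c, (r c).1 = i := fun c => by
      rcases em (p ∈ c) with h | h
      · rw [hup c (Cut.Iic_le_of_mem h)]
      · rw [hdown c (Cut.le_Iio_of_notMem h)]
    refine ⟨i, p, hP, hw, hv, fun l => ?_, fun q hq hlt => ?_⟩
    · obtain ⟨i', K, _, _, _, _, K', hag, h | h | h⟩ := hs l
      all_goals
        have he := h.1
        simp only [Prod.mk.injEq] at he
        obtain ⟨h1, ⟨rfl, rfl, -, -⟩, -⟩ := he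
        have := hi' (LowerSet.Iio l)
        rw [h1] at this
        simp only at this
        rwa [← this]
    · obtain ⟨i', K, _, _, _, _, K', -, h | h | h⟩ := hs q
      all_goals
        have he := h.1
        simp only [Prod.mk.injEq] at he
        obtain ⟨h1, ⟨rfl, rfl, rfl, rfl⟩, h2⟩ := he
        have hii := hi' (LowerSet.Iio q)
        rw [h1] at hii
        simp only at hii
        subst hii
      · rcases hlt with ⟨hpq, -⟩ | ⟨hqp, hK⟩
        · rw [hup _ (Cut.Iic_le_of_mem (LowerSet.mem_Iio_iff.2 hpq)), rankRun_Iio_of_lt hpq] at h1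
          simp at h1
        · rw [hdown _ (Cut.le_Iio_of_notMem (by simpa using hqp)), rankRun_Iic_of_gt hqp] at h2
          simp only [Prod.mk.injEq, true_and] at h2
          exact h.2.2 hq (h2 ▸ hK)
      · rcases hlt with ⟨hpq, -⟩ | ⟨hqp, hK⟩
        · rw [hup _ (Cut.Iic_le_of_mem (LowerSet.mem_Iio_iff.2 hpq)), rankRun_Iio_of_lt hpq] at h1
          simp at h1
        · rw [hdown _ (Cut.le_Iio_of_notMem (by simpa using hqp)), rankRun_Iic_of_gt hqp] at h2
          simp at h2
      · rcases hlt with ⟨hpq, hK⟩ | ⟨hqp, -⟩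
        · rw [hup _ (Cut.Iic_le_of_mem (LowerSet.mem_Iio_iff.2 hpq)), rankRun_Iio_of_lt hpq] at h1
          simp only [Prod.mk.injEq, true_and] at h1
          exact h.2.2 hq (h1 ▸ hK)
        · rw [hdown _ (Cut.le_Iio_of_notMem (by simpa using hqp)), rankRun_Iic_of_gt hqp] at h2
          simp at h2
  · rintro ⟨i, p, hp, hw, hv, hag, hq⟩
    refine ⟨fun c => (i, rankRun rk p c), (htame p hp).comp _, fun l => ?_, ?_, ?_⟩
    · beta_reduce
      rcases lt_trichotomy l p with hl | rfl | hl
      · rw [rankRun_Iio_of_gt hl, rankRun_Iic_of_gt hl]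
        exact ⟨i, _, _, _, _, _, _, hag l, Or.inl ⟨rfl, rfl, fun hl' hK => hq l hl'
          (Or.inr ⟨hl, hK⟩)⟩⟩
      · rw [rankRun_Iio_self, rankRun_Iic_self]
        exact ⟨i, 0, _, _, _, _, 0, hag l, Or.inr (Or.inl ⟨rfl, hp, hw, hv⟩)⟩
      · rw [rankRun_Iio_of_lt hl, rankRun_Iic_of_lt hl]
        exact ⟨i, _, _, _, _, _, _, hag l, Or.inr (Or.inr ⟨rfl, rfl, fun hl' hK => hq l hl'
          (Or.inl ⟨hl, hK⟩)⟩)⟩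
    · simp [rankRun_of_notMem (c := (⊥ : Cut L)) (p := p) LowerSet.notMem_bot]
    · simp [rankRun_of_mem (c := (⊤ : Cut L)) (p := p) LowerSet.mem_top]

end ranked

/-! ### Combs -/

section comb

variable {L : Type u} [LinearOrder L] {N : ℕ}

/-- `I` contains a comb of height `k`: for `k > 0`, a monotone or antitone sequence between whose
consecutive terms lie combs of smaller height. -/
def HasComb : ℕ → Set L → Prop
  | 0, I => I.Nonempty
  | k + 1, I => ∃ x : ℕ → L, (StrictMono x ∨ StrictAnti x) ∧ (∀ i, x i ∈ I) ∧
      ∀ i, HasComb k (Set.uIoo (x i) (x (i + 1)))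

theorem exists_strictMono_or_strictAnti_of_infinite {S : Set L} (hS : S.Infinite) :
    ∃ x : ℕ → L, (StrictMono x ∨ StrictAnti x) ∧ ∀ i, x i ∈ S := by
  have := hS.to_subtype
  let f := Infinite.natEmbedding S
  obtain ⟨g, hg⟩ := exists_increasing_or_nonincreasing_subseq (· < ·) fun n => (f n : L)
  refine ⟨fun n => f (g n), hg.imp (fun h m n hmn => h m n hmn) (fun h m n hmn => ?_),
    fun n => (f (g n)).2⟩
  refine lt_of_le_of_ne (not_lt.1 (h m n hmn)) fun he => ?_
  have := g.injective (f.injective (Subtype.ext he))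
  omega

/-- Representatives of infinitely many classes contain a monotone or antitone sequence. Consecutive
terms are inequivalent at level `k + 1`, so infinitely many classes of level `k` lie between them
and the induction continues in every gap. -/
theorem hasComb_of_infinite (k : ℕ) : ∀ I : Set L, I.OrdConnected →
    (condClass (k : Ordinal.{u}) '' I).Infinite → HasComb (k + 1) I := by
  induction k with
  | zero =>
    intro I hI h
    obtain ⟨x, hx, hxI⟩ := exists_strictMono_or_strictAnti_of_infinite h.of_image
    -- Taking every second term leaves a point in each gap.
    refine ⟨fun i => x (2 * i), hx.imp (fun h i j hij => h (by omega))
      (fun h i j hij => h (by omega)), fun i => hxI _, fun i => ⟨x (2 * i + 1), ?_⟩⟩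
    rcases hx with h | h
    · rw [Set.uIoo_of_le (h.monotone (by omega))]
      exact ⟨h (by omega), h (by omega)⟩
    · rw [Set.uIoo_of_ge (h.antitone (by omega))]
      exact ⟨h (by omega), h (by omega)⟩
  | succ k ih =>
    intro I hI h
    obtain ⟨s, hsI, hs⟩ := (Set.surjOn_image
      (condClass ((k + 1 : ℕ) : Ordinal.{u})) I).exists_bijOn_subset
    have hinf : s.Infinite := fun hfin => h (hs.image_eq ▸ hfin.image _)
    obtain ⟨x, hx, hxs⟩ := exists_strictMono_or_strictAnti_of_infinite hinf
    refine ⟨x, hx, fun i => hsI (hxs i), fun i => ih _ ?_ fun hfin => ?_⟩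
    · exact Set.ordConnected_Ioo
    · have hne : x i ≠ x (i + 1) := by
        rcases hx with h | h
        · exact (h (Nat.lt_succ_self i)).ne
        · exact (h (Nat.lt_succ_self i)).ne'
      refine hne (hs.injOn (hxs i) (hxs (i + 1)) (condClass_eq_iff.2 ?_))
      push_cast
      rw [condRel_succ]
      change (condClass (k : Ordinal.{u}) '' _).Finite
      refine ((hfin.insert (condClass (k : Ordinal.{u}) (x i))).insert
        (condClass (k : Ordinal.{u}) (x (i + 1)))).subset ?_
      rintro _ ⟨z, hz, rfl⟩
      by_cases h1 : z = x (i + 1)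
      · exact Or.inl (h1 ▸ rfl)
      by_cases h2 : z = x i
      · exact Or.inr (Or.inl (h2 ▸ rfl))
      refine Or.inr (Or.inr ⟨z, ?_, rfl⟩)
      rw [Set.uIcc, Set.mem_Icc] at hz
      rw [Set.uIoo, Set.mem_Ioo]
      refine ⟨hz.1.lt_of_ne ?_, hz.2.lt_of_ne ?_⟩
      · intro he
        rcases min_choice (x i) (x (i + 1)) with h | h <;> rw [h] at he
        · exact h2 he.symm
        · exact h1 he.symm
      · intro he
        rcases max_choice (x i) (x (i + 1)) with h | h <;> rw [h] at he
        · exact h2 he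
        · exact h1 he

/-! ### Ranking and enumerating a comb. -/

theorem rankRun_eq_of_agree {rk rk' : L → Fin (N + 1)} {p a b : L} (hap : a < p) (hpb : p < b)
    (h : ∀ l ∈ Set.Ioo a b, rk l = rk' l) {c : Cut L} (ha : a ∈ c) (hb : b ∉ c) :
    rankRun rk p c = rankRun rk' p c := by
  by_cases hp : p ∈ c
  · rw [rankRun_of_mem hp, rankRun_of_mem hp]
    congr 1
    refine maxRank_congr fun l hl => h l ⟨hap.trans hl.2, ?_⟩
    exact lt_of_not_ge fun hbl => hb (c.lower hbl hl.1)
  · rw [rankRun_of_notMem hp, rankRun_of_notMem hp]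
    congr 1
    refine maxRank_congr fun l hl => h l ⟨?_, hl.2.trans hpb⟩
    exact lt_of_not_ge fun hla => hl.1 (c.lower hla ha)

/-- Between `a` and `b` the run is that of `rk'`. Beyond them it is constant, because `a` and `b`
carry the greatest rank, so limits outside do no harm. -/
theorem tame_rankRun_of_agree {rk rk' : L → Fin (N + 1)} {p a b : L} (hap : a < p) (hpb : p < b)
    (h : ∀ l ∈ Set.Ioo a b, rk l = rk' l) (ha : ∀ l, rk l ≤ rk a) (hb : ∀ l, rk l ≤ rk b)
    (ht : Tame (rankRun rk' p)) : Tame (rankRun rk p) := by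
  have h1 : ∀ c : Cut L, a ∉ c → rankRun rk p c = (false, rk a) := by
    intro c hc
    rw [rankRun_of_notMem fun hp => hc (c.lower hap.le hp),
      maxRank_eq_of_mem (X := {l | l ∉ c ∧ l < p}) (l := a) ⟨hc, hap⟩ ha]
  have h2 : ∀ c : Cut L, b ∈ c → rankRun rk p c = (true, rk b) := by
    intro c hc
    rw [rankRun_of_mem (c.lower hpb.le hc), maxRank_eq_of_mem (X := {l | l ∈ c ∧ p < l}) (l := b) ⟨hc, hpb⟩ hb]
  have h3 : ∀ c : Cut L, a ∈ c → b ∉ c → rankRun rk p c = rankRun rk' p c := fun c =>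
    rankRun_eq_of_agree hap hpb h
  refine ⟨fun c hc hn => ?_, fun c hc hn => ?_⟩
  · by_cases hac : a ∈ c
    · by_cases hbc : b ∈ c
      · refine ⟨LowerSet.Iic b, (Cut.Iic_le_of_mem hbc).lt_of_ne ?_, fun e he _ => ?_⟩
        · rintro rfl
          exact hn ⟨_, Cut.Iio_covBy_Iic b⟩
        · rw [h2 c hbc, h2 e (he (LowerSet.mem_Iic_iff.2 le_rfl))]
      · obtain ⟨d, hd, hconst⟩ := ht.below c hc hn
        refine ⟨max d (LowerSet.Iic a), max_lt hd ((Cut.Iic_le_of_mem hac).lt_of_ne ?_),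
          fun e he hec => ?_⟩
        · rintro rfl
          exact hn ⟨_, Cut.Iio_covBy_Iic a⟩
        · rw [h3 c hac hbc, h3 e (((le_max_right _ _).trans he) (LowerSet.mem_Iic_iff.2 le_rfl))
            fun h => hbc (hec h)]
          exact hconst e ((le_max_left _ _).trans he) hec
    · exact ⟨⊥, bot_lt_iff_ne_bot.2 hc, fun e _ hec => by rw [h1 c hac, h1 e fun h => hac (hec h)]⟩
  · by_cases hac : a ∈ c
    · by_cases hbc : b ∈ c
      · exact ⟨⊤, lt_top_iff_ne_top.2 hc, fun e hce _ => by rw [h2 c hbc, h2 e (hce hbc)]⟩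
      · obtain ⟨d, hd, hconst⟩ := ht.above c hc hn
        refine ⟨min d (LowerSet.Iio b), lt_min hd ((Cut.le_Iio_of_notMem hbc).lt_of_ne ?_),
          fun e hce hed => ?_⟩
        · rintro rfl
          exact hn ⟨_, Cut.Iio_covBy_Iic b⟩
        · rw [h3 c hac hbc, h3 e (hce hac) fun h => lt_irrefl b
            (LowerSet.mem_Iio_iff.1 ((hed.trans (min_le_right _ _)) h))]
          exact hconst e hce (hed.trans (min_le_left _ _))
    · refine ⟨LowerSet.Iio a, (Cut.le_Iio_of_notMem hac).lt_of_ne ?_, fun e _ hed => ?_⟩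
      · rintro rfl
        exact hn ⟨_, Cut.Iio_covBy_Iic a⟩
      · rw [h1 c hac, h1 e fun h => lt_irrefl a (LowerSet.mem_Iio_iff.1 (hed h))]

/-- A ranking of `L` and an enumeration of points of `I`, in the order `rankLT`, by the ordinals
below `ω ^ m`. -/
structure IsRankedComb (m : ℕ) (I : Set L) (rk : L → Fin (N + 1)) (φ : Ordinal.{u} → L) :
    Prop where
  le : ∀ l, (rk l : ℕ) ≤ 2 * m + 1
  mem : ∀ a < ω ^ (m : Ordinal.{u}), φ a ∈ I
  rank : ∀ a b, a < b → b < ω ^ (m : Ordinal.{u}) → rankLT rk (φ a) (φ b)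
  tame : ∀ a < ω ^ (m : Ordinal.{u}), Tame (rankRun rk (φ a))

theorem tame_rankRun_zero (p : L) : Tame (rankRun (fun _ => (0 : Fin (N + 1))) p) := by
  have h : ∀ X : Set L, maxRank (fun _ => (0 : Fin (N + 1))) X = 0 := fun X =>
    le_antisymm (maxRank_le_iff.2 fun _ _ => le_rfl) (Fin.zero_le _)
  have h1 : ∀ c : Cut L, p ∈ c → rankRun (fun _ => (0 : Fin (N + 1))) p c = (true, 0) :=
    fun c hc => by rw [rankRun_of_mem hc, h]
  have h2 : ∀ c : Cut L, p ∉ c → rankRun (fun _ => (0 : Fin (N + 1))) p c = (false, 0) :=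
    fun c hc => by rw [rankRun_of_notMem hc, h]
  refine ⟨fun c hc hn => ?_, fun c hc hn => ?_⟩
  · by_cases hp : p ∈ c
    · refine ⟨LowerSet.Iic p, (Cut.Iic_le_of_mem hp).lt_of_ne ?_, fun e he _ => ?_⟩
      · rintro rfl
        exact hn ⟨_, Cut.Iio_covBy_Iic p⟩
      · rw [h1 c hp, h1 e (he (LowerSet.mem_Iic_iff.2 le_rfl))]
    · exact ⟨⊥, bot_lt_iff_ne_bot.2 hc, fun e _ hec => by rw [h2 c hp, h2 e fun h => hp (hec h)]⟩
  · by_cases hp : p ∈ c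
    · exact ⟨⊤, lt_top_iff_ne_top.2 hc, fun e hce _ => by rw [h1 c hp, h1 e (hce hp)]⟩
    · refine ⟨LowerSet.Iio p, (Cut.le_Iio_of_notMem hp).lt_of_ne ?_, fun e _ hed => ?_⟩
      · rintro rfl
        exact hn ⟨_, Cut.Iio_covBy_Iic p⟩
      · rw [h2 c hp, h2 e fun h => lt_irrefl p (LowerSet.mem_Iio_iff.1 (hed h))]

/-- The points of the sequence get the new rank `top`, above all ranks used inside the gaps. Points
of different gaps are then separated by rank `top`, whose parity records the direction of the
sequence; inside a gap the old ranking still decides. The enumerations are concatenated in type `ω ^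
m * ω`. -/
theorem IsRankedComb.glue {m : ℕ} {I : Set L} (hI : I.OrdConnected)
    {x : ℕ → L} {rks : ℕ → L → Fin (N + 1)} {φs : ℕ → Ordinal.{u} → L} {lo hi : ℕ → L}
    {top : Fin (N + 1)} (htop : 2 * m + 1 < (top : ℕ)) (htop' : (top : ℕ) ≤ 2 * (m + 1) + 1)
    (hx : ∀ i, x i ∈ I) (hlo : ∀ i, lo i ∈ Set.range x) (hhi : ∀ i, hi i ∈ Set.range x)
    (hxn : ∀ i j, x j ∉ Set.Ioo (lo i) (hi i))
    (hdisj : ∀ i j, i ≠ j → Disjoint (Set.Ioo (lo i) (hi i)) (Set.Ioo (lo j) (hi j)))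
    (hord : ∀ i j, i < j → (hi i ≤ lo j ∧ Odd (top : ℕ)) ∨ (hi j ≤ lo i ∧ Even (top : ℕ)))
    (h : ∀ i, IsRankedComb m (Set.Ioo (lo i) (hi i)) (rks i) (φs i)) :
    ∃ (rk : L → Fin (N + 1)) (φ : Ordinal.{u} → L), IsRankedComb (m + 1) I rk φ := by
  classical
  let rk : L → Fin (N + 1) := fun l => if l ∈ Set.range x then top else
    if h : ∃ i, l ∈ Set.Ioo (lo i) (hi i) then rks h.choose l else 0
  have hrkx : ∀ l ∈ Set.range x, rk l = top := fun l hl => if_pos hl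
  have hrki : ∀ i, ∀ l ∈ Set.Ioo (lo i) (hi i), rk l = rks i l := by
    intro i l hl
    have h1 : l ∉ Set.range x := by
      rintro ⟨j, rfl⟩
      exact hxn i j hl
    have h2 : ∃ i, l ∈ Set.Ioo (lo i) (hi i) := ⟨i, hl⟩
    have h3 : h2.choose = i := by
      by_contra hne
      exact Set.disjoint_left.1 (hdisj _ _ hne) h2.choose_spec hl
    simp only [rk, if_neg h1, dif_pos h2, h3]
  have hrkle : ∀ l, rk l ≤ top := by
    intro l
    simp only [rk]
    split_ifs with h1 h2
    · exact le_rfl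
    · exact Fin.le_def.2 (((h _).le l).trans htop.le)
    · exact Fin.zero_le _
  let nat : Ordinal.{u} → ℕ := fun o => Cardinal.toNat o.card
  have hnat : ∀ n : ℕ, nat n = n := fun n => by simp [nat]
  -- The quotient by `ω ^ m` selects the gap, the remainder the point in it.
  let φ : Ordinal.{u} → L := fun a => φs (nat (a / ω ^ (m : Ordinal.{u}))) (a % ω ^ (m : Ordinal.{u}))
  have hpos : (0 : Ordinal.{u}) < ω ^ (m : Ordinal.{u}) := opow_pos _ omega0_pos
  have hdec : ∀ a < ω ^ (((m + 1 : ℕ) : Ordinal.{u})), ∃ (i : ℕ) (a' : Ordinal.{u}),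
      a' < ω ^ (m : Ordinal.{u}) ∧ a = ω ^ (m : Ordinal.{u}) * i + a' ∧ φ a = φs i a' := by
    intro a ha
    rw [Nat.cast_add_one, opow_add, opow_one] at ha
    have h1 : a / ω ^ (m : Ordinal.{u}) < ω := (Ordinal.lt_mul_iff_div_lt hpos.ne').1 ha
    obtain ⟨i, hi⟩ := lt_omega0.1 h1
    refine ⟨i, a % ω ^ (m : Ordinal.{u}), Ordinal.mod_lt _ hpos.ne', ?_, ?_⟩
    · rw [← hi]; exact (Ordinal.div_add_mod _ _).symm
    · simp only [φ, hi, hnat]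
  refine ⟨rk, φ, ⟨fun l => ?_, fun a ha => ?_, fun a b hab hb => ?_, fun a ha => ?_⟩⟩
  · exact (Fin.le_def.1 (hrkle l)).trans htop'
  · obtain ⟨i, a', ha', -, he⟩ := hdec a ha
    rw [he]
    obtain ⟨j, hj⟩ := hlo i
    obtain ⟨k, hk⟩ := hhi i
    exact hI.out (hj ▸ hx j) (hk ▸ hx k) (Set.Ioo_subset_Icc_self ((h i).mem a' ha'))
  · obtain ⟨i, a', ha', hae, hea⟩ := hdec a (hab.trans hb)
    obtain ⟨j, b', hb', hbe, heb⟩ := hdec b hb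
    have hmx : ∀ p q y, p < y → y < q → y ∈ Set.range x → maxRank rk (Set.Ioo p q) = top := by
      intro p q y hpy hyq hy
      rw [maxRank_eq_of_mem (X := Set.Ioo p q) (l := y) ⟨hpy, hyq⟩ fun l => (hrkle l).trans (hrkx y hy).ge, hrkx y hy]
    rw [hea, heb]
    have hi1 := (h i).mem a' ha'
    have hj1 := (h j).mem b' hb'
    rcases lt_trichotomy i j with hij | rfl | hij
    · rcases hord i j hij with ⟨h1, h2⟩ | ⟨h1, h2⟩
      · refine Or.inl ⟨hi1.2.trans_le (h1.trans hj1.1.le), ?_⟩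
        rwa [hmx _ _ (hi i) hi1.2 (h1.trans_lt hj1.1) (hhi i)]
      · refine Or.inr ⟨hj1.2.trans_le (h1.trans hi1.1.le), ?_⟩
        rwa [hmx _ _ (hi j) hj1.2 (h1.trans_lt hi1.1) (hhi j)]
    · have hab' : a' < b' := by
        rw [hae, hbe] at hab
        exact (add_lt_add_iff_left _).1 hab
      rcases (h i).rank a' b' hab' hb' with ⟨h1, h2⟩ | ⟨h1, h2⟩
      · refine Or.inl ⟨h1, ?_⟩
        rwa [maxRank_congr fun l hl => hrki i l ⟨hi1.1.trans hl.1, hl.2.trans hj1.2⟩]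
      · refine Or.inr ⟨h1, ?_⟩
        rwa [maxRank_congr fun l hl => hrki i l ⟨hj1.1.trans hl.1, hl.2.trans hi1.2⟩]
    · exfalso
      refine absurd hab (not_lt.2 ?_)
      rw [hae, hbe]
      calc ω ^ (m : Ordinal.{u}) * (j : Ordinal.{u}) + b'
          ≤ ω ^ (m : Ordinal.{u}) * (j : Ordinal.{u}) + ω ^ (m : Ordinal.{u}) := by gcongr
        _ = ω ^ (m : Ordinal.{u}) * ((j + 1 : ℕ) : Ordinal.{u}) := by
            rw [Nat.cast_add_one, mul_add, mul_one]
        _ ≤ ω ^ (m : Ordinal.{u}) * (i : Ordinal.{u}) := by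
            gcongr
            omega
        _ ≤ _ := le_self_add
  · obtain ⟨i, a', ha', -, he⟩ := hdec a ha
    rw [he]
    have hi1 := (h i).mem a' ha'
    exact tame_rankRun_of_agree hi1.1 hi1.2 (hrki i)
      (fun l => (hrkle l).trans (hrkx _ (hlo i)).ge) (fun l => (hrkle l).trans (hrkx _ (hhi i)).ge)
      ((h i).tame a' ha')

theorem exists_isRankedComb (m : ℕ) (hm : 2 * m + 1 ≤ N) : ∀ I : Set L, I.OrdConnected →
    HasComb m I → ∃ (rk : L → Fin (N + 1)) (φ : Ordinal.{u} → L), IsRankedComb m I rk φ := by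
  induction m with
  | zero =>
    rintro I - ⟨p, hp⟩
    refine ⟨fun _ => 0, fun _ => p, ⟨fun _ => by simp, fun _ _ => hp, fun a b hab hb => ?_,
      fun _ _ => tame_rankRun_zero p⟩⟩
    simp only [Nat.cast_zero, opow_zero, Order.lt_one_iff] at hb
    exact absurd (hb ▸ hab) not_lt_zero
  | succ m ih =>
    rintro I hI ⟨x, hx, hxI, hc⟩
    choose rks φs h using fun i => ih (by omega) (Set.uIoo (x i) (x (i + 1)))
      Set.ordConnected_Ioo (hc i)
    rcases hx with hx | hx
    · have hu : ∀ i, Set.uIoo (x i) (x (i + 1)) = Set.Ioo (x i) (x (i + 1)) := fun i =>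
        Set.uIoo_of_le (hx.monotone (Nat.le_succ i))
      -- Each level owns two ranks above all earlier ones: the odd one for an increasing sequence,
      -- and below, the even one for a decreasing sequence.
      refine IsRankedComb.glue hI (lo := x) (hi := fun i => x (i + 1))
        (top := ⟨2 * (m + 1) + 1, by omega⟩) (by simp) (by simp) hxI (fun i => ⟨i, rfl⟩)
        (fun i => ⟨i + 1, rfl⟩) ?_ ?_ (fun i j hij => Or.inl ⟨hx.monotone hij, ?_⟩)
        fun i => hu i ▸ h i
      · rintro i j ⟨h1, h2⟩
        have := hx.lt_iff_lt.1 h1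
        have := hx.lt_iff_lt.1 h2
        omega
      · intro i j hij
        rw [Set.disjoint_left]
        rintro z ⟨h1, h2⟩ ⟨h3, h4⟩
        have := hx.lt_iff_lt.1 (h1.trans h4)
        have := hx.lt_iff_lt.1 (h3.trans h2)
        omega
      · simp [parity_simps]
    · have hu : ∀ i, Set.uIoo (x i) (x (i + 1)) = Set.Ioo (x (i + 1)) (x i) := fun i =>
        Set.uIoo_of_ge (hx.antitone (Nat.le_succ i))
      refine IsRankedComb.glue hI (lo := fun i => x (i + 1)) (hi := x)
        (top := ⟨2 * (m + 1), by omega⟩) (by simp; omega) (by simp) hxI (fun i => ⟨i + 1, rfl⟩)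
        (fun i => ⟨i, rfl⟩) ?_ ?_ (fun i j hij => Or.inr ⟨hx.antitone hij, by simp⟩)
        fun i => hu i ▸ h i
      · rintro i j ⟨h1, h2⟩
        have := hx.lt_iff_gt.1 h1
        have := hx.lt_iff_gt.1 h2
        omega
      · intro i j hij
        rw [Set.disjoint_left]
        rintro z ⟨h1, h2⟩ ⟨h3, h4⟩
        have := hx.lt_iff_gt.1 (h1.trans h4)
        have := hx.lt_iff_gt.1 (h3.trans h2)
        omega

end comb

/-! ### Finite sets in the colexicographic order -/

section colex

/-- The greatest element of `t \ s` is the place of last difference; this form is what an automaton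
can test. -/
theorem Finset.toColex_lt_iff_exists_agree {U : Type*} [LinearOrder U] {s t : Finset U} :
    toColex s < toColex t ↔ ∃ a ∈ t, a ∉ s ∧ ∀ b, a < b → (b ∈ s ↔ b ∈ t) := by
  rw [Finset.Colex.toColex_lt_toColex_iff_exists_forall_lt]
  constructor
  · rintro ⟨a, hat, has, h⟩
    obtain ⟨c, hc, hmax⟩ := (t \ s).exists_max_image id ⟨a, Finset.mem_sdiff.2 ⟨hat, has⟩⟩
    rw [Finset.mem_sdiff] at hc
    have hac : a ≤ c := hmax a (Finset.mem_sdiff.2 ⟨hat, has⟩)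
    refine ⟨c, hc.1, hc.2, fun b hb => ⟨fun hbs => ?_, fun hbt => ?_⟩⟩
    · by_contra hbt
      exact absurd (h b hbs hbt) (not_lt.2 (hac.trans hb.le))
    · by_contra hbs
      exact absurd (hmax b (Finset.mem_sdiff.2 ⟨hbt, hbs⟩)) (not_le.2 hb)
  · rintro ⟨a, hat, has, h⟩
    refine ⟨a, hat, has, fun b hbs hbt => lt_of_not_ge fun hab => ?_⟩
    rcases hab.eq_or_lt with rfl | hab
    · exact has hbs
    · exact hbt ((h b hab).1 hbs)

/-- Indicator functions turn colex into a lexicographic order on finitely supported functions with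
reversed index order, which is well-founded. -/
theorem Finset.wellFoundedLT_colex (U : Type*) [LinearOrder U] [WellFoundedLT U] :
    WellFoundedLT (Colex (Finset U)) := by
  classical
  have hwf : WellFounded (Finsupp.Lex (fun a b : U => b < a) (fun a b : ℕ => a < b)) :=
    Finsupp.Lex.wellFounded' (fun n => Nat.not_lt_zero n) wellFounded_lt
      (wellFounded_lt (α := U))
  let f : Colex (Finset U) → U →₀ ℕ := fun s => Finsupp.indicator (ofColex s) fun _ _ => 1
  have hf : ∀ s a, f s a = if a ∈ ofColex s then 1 else 0 := fun s a => by
    simp [f, Finsupp.indicator_apply]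
  refine ⟨Subrelation.wf (fun {s t} hst => ?_) (InvImage.wf f hwf)⟩
  obtain ⟨a, hat, has, h⟩ := Finset.toColex_lt_iff_exists_agree.1
    (show toColex (ofColex s) < toColex (ofColex t) from hst)
  refine ⟨a, fun b hb => ?_, ?_⟩
  · rw [hf, hf]; simp [h b hb]
  · rw [hf, hf]; simp [hat, has]

/-! ### Binary expansions and initial segments of the colex order. -/

/-- The exponents in the binary expansion of an ordinal. -/
noncomputable def binaryExponents (γ : Ordinal.{u}) : Finset Ordinal.{u} :=
  open Classical in
  if h : γ = 0 then ∅ else insert (log 2 γ) (binaryExponents (γ % 2 ^ log 2 γ))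
termination_by γ
decreasing_by exact mod_opow_log_lt_self 2 h

theorem binaryExponents_zero : binaryExponents (0 : Ordinal.{u}) = ∅ := by
  rw [binaryExponents, dif_pos rfl]

theorem mem_binaryExponents {γ : Ordinal.{u}} (h : γ ≠ 0) {e : Ordinal.{u}} :
    e ∈ binaryExponents γ ↔ e = log 2 γ ∨ e ∈ binaryExponents (γ % 2 ^ log 2 γ) := by
  rw [binaryExponents, dif_neg h, Finset.mem_insert]

theorem lt_of_mem_binaryExponents {γ : Ordinal.{u}} : ∀ {d : Ordinal.{u}}, γ < 2 ^ d →
    ∀ e ∈ binaryExponents γ, e < d := by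
  induction γ using WellFoundedLT.induction with | _ γ ih
  intro d hd e he
  rcases eq_or_ne γ 0 with rfl | h
  · simp [binaryExponents_zero] at he
  rcases (mem_binaryExponents h).1 he with rfl | he
  · exact (lt_opow_iff_log_lt one_lt_two h).1 hd
  · exact ih _ (mod_opow_log_lt_self 2 h) ((mod_opow_log_lt_self 2 h).trans hd) e he

/-- Either the leading exponent of `γ'` already exceeds all exponents of `γ`, or the leading
exponents coincide and the remainders decide by induction. -/
theorem exists_binaryExponents_agree {γ' : Ordinal.{u}} : ∀ {γ : Ordinal.{u}}, γ < γ' →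
    ∃ a ∈ binaryExponents γ', a ∉ binaryExponents γ ∧
      ∀ b, a < b → (b ∈ binaryExponents γ ↔ b ∈ binaryExponents γ') := by
  induction γ' using WellFoundedLT.induction with | _ γ' ih
  intro γ hlt
  have h' : γ' ≠ 0 := (hlt.trans_le' (zero_le)).ne'
  have hmod : ∀ x y : Ordinal.{u}, x % 2 ^ y < 2 ^ y := fun x y =>
    Ordinal.mod_lt _ (opow_ne_zero _ two_ne_zero)
  rcases lt_or_ge γ (2 ^ log 2 γ') with h | h
  · refine ⟨log 2 γ', (mem_binaryExponents h').2 (Or.inl rfl),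
      fun hm => lt_irrefl _ (lt_of_mem_binaryExponents h _ hm), fun b hb => ⟨fun hm => ?_,
        fun hm => ?_⟩⟩
    · exact absurd (lt_of_mem_binaryExponents h _ hm) (not_lt.2 hb.le)
    · rcases (mem_binaryExponents h').1 hm with rfl | hm
      · exact absurd hb (lt_irrefl _)
      · exact absurd (lt_of_mem_binaryExponents (hmod _ _) _ hm) (not_lt.2 hb.le)
  · have h0 : γ ≠ 0 := by
      rintro rfl
      exact absurd h (not_le.2 (opow_pos _ two_pos))
    have hlog : log 2 γ = log 2 γ' :=
      le_antisymm (log_mono_right 2 hlt.le) (le_log_of_opow_le one_lt_two h)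
    have hrem : γ % 2 ^ log 2 γ' < γ' % 2 ^ log 2 γ' := by
      have h1 := two_opow_log_add h0
      have h2 := two_opow_log_add h'
      rw [hlog] at h1
      rw [← add_lt_add_iff_left (2 ^ log 2 γ'), h1, h2]
      exact hlt
    obtain ⟨a, ha, ha', hb⟩ := ih _ (mod_opow_log_lt_self 2 h') hrem
    have hal := lt_of_mem_binaryExponents (hmod _ _) _ ha
    refine ⟨a, (mem_binaryExponents h').2 (Or.inr ha), fun hm => ?_, fun b hab => ?_⟩
    · rcases (mem_binaryExponents h0).1 hm with h1 | h1
      · exact absurd hal (h1 ▸ hlog ▸ lt_irrefl _)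
      · exact ha' (hlog ▸ h1)
    · rw [mem_binaryExponents h0, mem_binaryExponents h', hlog, hb b hab]

theorem two_opow_le_type_colex (δ : Ordinal.{u}) [WellFoundedLT (Colex (Finset δ.ToType))] :
    2 ^ δ ≤ typeLT (Colex (Finset δ.ToType)) := by
  have hinj : ∀ s : Finset Ordinal.{u}, Set.InjOn
      (fun x : δ.ToType => typein (fun a b : δ.ToType => a < b) x)
      ((fun x : δ.ToType => typein (fun a b : δ.ToType => a < b) x) ⁻¹' s) :=
    fun s x _ y _ h => typein_injective _ h
  let f : ((2 : Ordinal.{u}) ^ δ).ToType → Colex (Finset δ.ToType) := fun x =>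
    toColex ((binaryExponents (typein (fun a b : ((2 : Ordinal.{u}) ^ δ).ToType => a < b) x)).preimage
      (fun x : δ.ToType => typein (fun a b : δ.ToType => a < b) x) (hinj _))
  have hf : StrictMono f := by
    intro x y hxy
    obtain ⟨a, ha, ha', h⟩ := exists_binaryExponents_agree
      ((typein_lt_typein (fun a b : ((2 : Ordinal.{u}) ^ δ).ToType => a < b)).2 hxy)
    have had := lt_of_mem_binaryExponents (typein_lt_self y) a ha
    obtain ⟨b, rfl⟩ := typein_surj (fun a b : δ.ToType => a < b) (by rwa [type_toType])
    refine Finset.toColex_lt_iff_exists_agree.2 ⟨b, Finset.mem_preimage.2 ha,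
      fun hm => ha' (Finset.mem_preimage.1 hm), fun c hc => ?_⟩
    rw [Finset.mem_preimage, Finset.mem_preimage]
    exact h _ ((typein_lt_typein _).2 hc)
  have := (OrderEmbedding.ofStrictMono f hf).ltEmbedding.ordinal_type_le
  rwa [type_toType] at this

/-- Binary expansion embeds `2 ^ δ` into the colex order, so `β` is the segment strictly below some
finite set `t`. A single bound suffices to define the domain, and it can be stored in the oracle. -/
theorem exists_colex_initialSegment {β δ : Ordinal.{u}} (h : β < 2 ^ δ) :
    ∃ (E : β.ToType → Finset δ.ToType) (t : Finset δ.ToType),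
      (∀ x y, toColex (E x) ≤ toColex (E y) ↔ x ≤ y) ∧
      ∀ s, toColex s < toColex t ↔ ∃ x, E x = s := by
  have := Finset.wellFoundedLT_colex δ.ToType
  obtain ⟨t, ht⟩ := typein_surj (fun a b : Colex (Finset δ.ToType) => a < b)
    (h.trans_le (two_opow_le_type_colex δ))
  have hβ : typeLT β.ToType = typeLT (Set.Iio t) := by
    rw [type_toType, type_Iio_lt, ht]
  obtain ⟨f⟩ := Ordinal.type_eq.1 hβ
  have hf : ∀ x y, f x ≤ f y ↔ x ≤ y := fun x y => by
    rw [← not_lt, ← not_lt]; exact not_congr f.map_rel_iff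
  refine ⟨fun x => ofColex (f x).1, ofColex t, fun x y => hf x y, fun s => ⟨fun hs => ?_, ?_⟩⟩
  · exact ⟨f.symm ⟨toColex s, hs⟩, by simp⟩
  · rintro ⟨x, rfl⟩
    exact (f x).2

/-- `2 ^ ω = ω` and `ω * ω ^ m = ω ^ m * ω` give `ω ^ (ω ^ m) = 2 ^ (ω ^ m * ω)`, the limit of the
powers `2 ^ (ω ^ m * k)`. -/
theorem exists_lt_two_opow_mul {β : Ordinal.{u}} {m : ℕ} (h : β < ω ^ (ω ^ (m : Ordinal.{u}))) :
    ∃ k : ℕ, β < 2 ^ (ω ^ (m : Ordinal.{u}) * (k : Ordinal.{u})) := by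
  have h1 : (ω : Ordinal.{u}) ^ (ω ^ (m : Ordinal.{u})) = 2 ^ (ω ^ (m : Ordinal.{u}) * ω) := by
    have h2 : (2 : Ordinal.{u}) ^ ω = ω := by
      exact_mod_cast natCast_opow_omega0 (n := 2) one_lt_two
    have h3 : ω ^ (m : Ordinal.{u}) * ω = ω * ω ^ (m : Ordinal.{u}) := by
      rw [opow_natCast, ← pow_succ, ← pow_succ']
    rw [h3, opow_mul, h2]
  rw [h1] at h
  have hlim : Order.IsSuccLimit (ω ^ (m : Ordinal.{u}) * ω : Ordinal.{u}) :=
    isSuccLimit_mul_right (opow_pos _ omega0_pos) isSuccLimit_omega0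
  obtain ⟨d, hd, hβ⟩ := (lt_opow_of_isSuccLimit two_ne_zero hlim).1 h
  have h2 := (Ordinal.lt_mul_iff_div_lt (opow_pos (m : Ordinal.{u}) omega0_pos).ne').1 hd
  obtain ⟨k, hk⟩ := lt_omega0.1 h2
  refine ⟨k + 1, hβ.trans ?_⟩
  rw [opow_lt_opow_iff_right one_lt_two, Ordinal.lt_mul_iff_div_lt (opow_pos _ omega0_pos).ne', hk]
  exact_mod_cast Nat.lt_succ_self k

end colex

/-! ### Words for finite sets -/

section trackWord

set_option linter.unusedSectionVars false

variable {L : Type u} [LinearOrder L] {U : Type u} [LinearOrder U] {k N : ℕ}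

open Classical in
/-- The word of a finite set `s`: the letter at `l` is the set of the tracks of the elements of `s`
whose point is `l`, or blank if there are none. -/
noncomputable def trackWord (pt : U → L) (tr : U → Fin k) (s : Finset U) (l : L) :
    Option (Set (Fin k)) :=
  if ∃ u ∈ s, pt u = l then some {i | ∃ u ∈ s, tr u = i ∧ pt u = l} else none

/-- The elements of `U` correspond to the pairs of a track and a point of `P`, ordered by the track
first. -/
structure IsTracking (P : Set L) (rk : L → Fin (N + 1)) (pt : U → L) (tr : U → Fin k) : Prop where
  mem : ∀ u, pt u ∈ P
  surj : ∀ i, ∀ p ∈ P, ∃ u, tr u = i ∧ pt u = p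
  inj : ∀ u v, tr u = tr v → pt u = pt v → u = v
  lt_iff : ∀ u v, u < v ↔ tr u < tr v ∨ (tr u = tr v ∧ rankLT rk (pt u) (pt v))

variable {P : Set L} {rk : L → Fin (N + 1)} {pt : U → L} {tr : U → Fin k}

theorem inLetter_trackWord {s : Finset U} {l : L} {i : Fin k} :
    inLetter (trackWord pt tr s l) i ↔ ∃ u ∈ s, tr u = i ∧ pt u = l := by
  unfold inLetter trackWord
  split_ifs with h
  · simp
  · simp only [false_and, exists_false, false_iff]
    rintro ⟨u, hu, -, hl⟩
    exact h ⟨u, hu, hl⟩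

theorem IsTracking.inLetter_trackWord_iff (h : IsTracking P rk pt tr) {s : Finset U} {u : U} :
    inLetter (trackWord pt tr s (pt u)) (tr u) ↔ u ∈ s := by
  rw [inLetter_trackWord]
  constructor
  · rintro ⟨v, hv, h1, h2⟩
    rwa [← h.inj v u h1 h2]
  · exact fun hu => ⟨u, hu, rfl, rfl⟩

theorem IsTracking.trackWord_injective (h : IsTracking P rk pt tr) :
    Function.Injective (trackWord pt tr) := by
  intro s t hst
  ext u
  rw [← h.inLetter_trackWord_iff, hst, h.inLetter_trackWord_iff]

theorem IsTracking.trackLT_trackWord_iff (h : IsTracking P rk pt tr) {s t : Finset U} :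
    trackLT P rk (trackWord pt tr s) (trackWord pt tr t) ↔ toColex s < toColex t := by
  rw [Finset.toColex_lt_iff_exists_agree]
  constructor
  · rintro ⟨i, p, hp, hs, ht, hag, hq⟩
    obtain ⟨u, rfl, rfl⟩ := h.surj i p hp
    rw [h.inLetter_trackWord_iff] at hs ht
    refine ⟨u, ht, hs, fun v huv => ?_⟩
    rw [← h.inLetter_trackWord_iff, ← h.inLetter_trackWord_iff (s := t)]
    rcases (h.lt_iff u v).1 huv with h1 | ⟨h1, h2⟩
    · exact hag _ _ h1
    · rw [← h1]
      exact hq _ (h.mem v) h2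
  · rintro ⟨u, ht, hs, hag⟩
    refine ⟨tr u, pt u, h.mem u, fun h' => hs (h.inLetter_trackWord_iff.1 h'),
      h.inLetter_trackWord_iff.2 ht, fun l j hj => ?_, fun q hq hlt => ?_⟩
    · rw [inLetter_trackWord, inLetter_trackWord]
      have : ∀ v, tr v = j → (v ∈ s ↔ v ∈ t) := fun v hv =>
        hag v ((h.lt_iff u v).2 (Or.inl (hv ▸ hj)))
      constructor
      · rintro ⟨v, hv, h1, h2⟩
        exact ⟨v, (this v h1).1 hv, h1, h2⟩
      · rintro ⟨v, hv, h1, h2⟩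
        exact ⟨v, (this v h1).2 hv, h1, h2⟩
    · obtain ⟨v, hv, rfl⟩ := h.surj (tr u) q hq
      rw [← hv, h.inLetter_trackWord_iff, h.inLetter_trackWord_iff]
      exact hag v ((h.lt_iff u v).2 (Or.inr ⟨hv.symm, hlt⟩))

/-- The letter `some ∅` must be excluded: it would be a second code for an empty position beside the
blank. -/
theorem IsTracking.exists_trackWord_eq (h : IsTracking P rk pt tr) {w : L → Option (Set (Fin k))}
    (hfin : IsFiniteWord w) (hP : ∀ l, w l ≠ none → l ∈ P) (hne : ∀ l, w l ≠ some ∅) :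
    ∃ s, w = trackWord pt tr s := by
  have hs : {u | inLetter (w (pt u)) (tr u)}.Finite := by
    refine Set.Finite.of_injOn (f := fun u => (tr u, pt u)) (t := Set.univ ×ˢ {l | w l ≠ none}) ?_ ?_
      (Set.finite_univ.prod hfin)
    · rintro u ⟨B, hB, -⟩
      exact ⟨trivial, by simp [hB]⟩
    · intro u _ v _ huv
      exact h.inj u v (congrArg Prod.fst huv) (congrArg Prod.snd huv)
  refine ⟨hs.toFinset, funext fun l => ?_⟩
  unfold trackWord
  split_ifs with hl
  · obtain ⟨u, hu, rfl⟩ := hl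
    obtain ⟨B, hB, -⟩ := hs.mem_toFinset.1 hu
    rw [hB]
    congr 1
    ext i
    constructor
    · intro hi
      obtain ⟨v, rfl, hv⟩ := h.surj i (pt u) (h.mem u)
      refine ⟨v, hs.mem_toFinset.2 ?_, rfl, hv⟩
      exact ⟨B, by rw [hv, hB], hi⟩
    · rintro ⟨v, hv, rfl, hvu⟩
      obtain ⟨B', hB', hi⟩ := hs.mem_toFinset.1 hv
      rw [hvu, hB, Option.some_inj] at hB'
      rwa [hB']
  · by_contra hwl
    obtain ⟨B, hB⟩ := Option.ne_none_iff_exists'.1 hwl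
    obtain ⟨i, hi⟩ : B.Nonempty := by
      rw [Set.nonempty_iff_ne_empty]
      rintro rfl
      exact hne l hB
    obtain ⟨u, rfl, rfl⟩ := h.surj i l (hP l hwl)
    exact hl ⟨u, hs.mem_toFinset.2 ⟨B, hB, hi⟩, rfl⟩

theorem isFiniteWord_trackWord (s : Finset U) : IsFiniteWord (trackWord pt tr s) := by
  refine (s.finite_toSet.image pt).subset fun l hl => ?_
  by_contra hcon
  refine hl (if_neg ?_)
  rintro ⟨u, hu, h⟩
  exact hcon ⟨u, hu, h⟩

/-- With `P`, `rk` and the word of `t` in the oracle, both the domain (proper codes below `t`) and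
the order (equality or `trackLT` on the domain) are Boolean combinations of tamely recognizable
sets. -/
theorem IsTracking.isFiniteWordOracleAutomaticOrdinal (h : IsTracking P rk pt tr)
    (htame : ∀ p ∈ P, Tame (rankRun rk p)) {β : Ordinal.{u}} {E : β.ToType → Finset U}
    {t : Finset U} (hE : ∀ x y, toColex (E x) ≤ toColex (E y) ↔ x ≤ y)
    (hEt : ∀ s, toColex s < toColex t ↔ ∃ x, E x = s) :
    IsFiniteWordOracleAutomaticOrdinal L β := by
  obtain ⟨X, hX, hXiff⟩ := isTamelyRecognizable_trackLT k P rk htame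
  let Ω := Prop × Fin (N + 1) × Option (Set (Fin k))
  let o : L → Option Ω := fun l => some (l ∈ P, rk l, trackWord pt tr t l)
  -- The default value is irrelevant on the actual oracle, which is nowhere blank.
  let d : Option Ω → Ω := fun c => c.getD (False, 0, none)
  let D : Set (L → Option (Set (Fin k)) × Option Ω) :=
    ({w | {l | w l ∈ {a | a.1 ≠ none}}.Finite} ∩
      {w | ∀ l, w l ∈ {a | (a.1 ≠ none → (d a.2).1) ∧ a.1 ≠ some ∅}}) ∩
      {w | (fun l => ((w l).1, (d (w l).2).2.2, (d (w l).2).1, (d (w l).2).2.1)) ∈ X}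
  have hD : IsTamelyRecognizable D :=
    ((IsTamelyRecognizable.finite _).inter (IsTamelyRecognizable.letters _)).inter
      (hX.comap fun a : Option (Set (Fin k)) × Option Ω =>
        (a.1, (d a.2).2.2, (d a.2).1, (d a.2).2.1))
  have hDiff : ∀ w, conv w o ∈ D ↔ ∃ x, trackWord pt tr (E x) = w := by
    intro w
    constructor
    · rintro ⟨⟨h1, h2⟩, h3⟩
      obtain ⟨s, rfl⟩ := h.exists_trackWord_eq (w := w) h1 (fun l => (h2 l).1) fun l => (h2 l).2
      have h4 : trackLT P rk (trackWord pt tr s) (trackWord pt tr t) := (hXiff _ _).1 h3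
      rw [h.trackLT_trackWord_iff, hEt] at h4
      obtain ⟨x, rfl⟩ := h4
      exact ⟨x, rfl⟩
    · rintro ⟨x, rfl⟩
      refine ⟨⟨isFiniteWord_trackWord _, fun l => ⟨fun hl => ?_, ?_⟩⟩, (hXiff _ _).2 ?_⟩
      · by_contra hP
        refine hl (if_neg ?_)
        rintro ⟨u, -, rfl⟩
        exact hP (h.mem u)
      · change trackWord pt tr (E x) l ≠ some ∅
        unfold trackWord
        split_ifs with hl
        · obtain ⟨u, hu, rfl⟩ := hl
          rw [Ne, Option.some_inj, ← Ne, ← Set.nonempty_iff_ne_empty]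
          exact ⟨tr u, u, hu, rfl, rfl⟩
        · simp
      · exact h.trackLT_trackWord_iff.2 ((hEt _).2 ⟨x, rfl⟩)
  let Y : Set (L → Option (Set (Fin k)) × Option (Set (Fin k)) × Option Ω) :=
    ({w | (fun l => ((w l).1, (w l).2.2)) ∈ D} ∩ {w | (fun l => ((w l).2.1, (w l).2.2)) ∈ D}) ∩
      ({w | ∀ l, w l ∈ {a | a.1 = a.2.1}} ∪
        {w | (fun l => ((w l).1, (w l).2.1, (d (w l).2.2).1, (d (w l).2.2).2.1)) ∈ X})
  have hY : IsTamelyRecognizable Y :=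
    ((hD.comap fun a => (a.1, a.2.2)).inter (hD.comap fun a => (a.2.1, a.2.2))).inter
      ((IsTamelyRecognizable.letters _).union
        (hX.comap fun a : Option (Set (Fin k)) × Option (Set (Fin k)) × Option Ω =>
          (a.1, a.2.1, (d a.2.2).1, (d a.2.2).2.1)))
  obtain ⟨M, hM⟩ := hD.exists_limitAutomaton
  obtain ⟨M', hM'⟩ := hY.exists_limitAutomaton
  refine ⟨Set (Fin k), Ω, inferInstance, inferInstance, o, M, M', fun x => trackWord pt tr (E x),
    fun x y hxy => ?_, ?_, fun w hw => ?_, ?_⟩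
  · have := h.trackWord_injective hxy
    exact le_antisymm ((hE x y).1 (by rw [this])) ((hE y x).1 (by rw [this]))
  · ext w
    rw [Set.mem_ofPred_eq, hM, hDiff]
    rfl
  · obtain ⟨x, rfl⟩ := (hDiff w).1 ((hM _).1 hw)
    exact isFiniteWord_trackWord _
  · ext ⟨w, w'⟩
    rw [Set.mem_ofPred_eq, hM']
    constructor
    · rintro ⟨⟨h1, h2⟩, h3⟩
      obtain ⟨x, rfl⟩ := (hDiff w).1 h1
      obtain ⟨y, rfl⟩ := (hDiff w').1 h2
      refine ⟨x, y, (hE x y).1 ?_, rfl⟩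
      rcases h3 with h3 | h3
      · have : trackWord pt tr (E x) = trackWord pt tr (E y) := funext h3
        rw [h.trackWord_injective this]
      · have h4 : trackLT P rk (trackWord pt tr (E x)) (trackWord pt tr (E y)) := (hXiff _ _).1 h3
        exact (h.trackLT_trackWord_iff.1 h4).le
    · rintro ⟨x, y, hxy, he⟩
      obtain ⟨rfl, rfl⟩ := Prod.mk.inj he
      refine ⟨⟨(hDiff _).2 ⟨x, rfl⟩, (hDiff _).2 ⟨y, rfl⟩⟩, ?_⟩
      rcases ((hE x y).2 hxy).eq_or_lt with h1 | h1
      · left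
        intro l
        change trackWord pt tr (E x) l = trackWord pt tr (E y) l
        rw [toColex_inj.1 h1]
      · right
        exact (hXiff _ _).2 (h.trackLT_trackWord_iff.2 h1)

theorem rankLT_asymm {p q : L} (h : rankLT rk p q) : ¬ rankLT rk q p := by
  rintro (⟨h1, h2⟩ | ⟨h1, h2⟩) <;> rcases h with ⟨h3, h4⟩ | ⟨h3, h4⟩
  · exact lt_asymm h1 h3
  · exact Nat.not_even_iff_odd.2 h2 h4
  · exact Nat.not_even_iff_odd.2 h4 h2
  · exact lt_asymm h1 h3

/-- An ordinal below `ω ^ m * k` is a quotient below `k`, its track, and a remainder below `ω ^ m`,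
the index of its point. Distinct indices give distinct points because `rankLT` is asymmetric. -/
theorem IsRankedComb.exists_isTracking {m : ℕ} {I : Set L} {φ : Ordinal.{u} → L}
    (h : IsRankedComb m I rk φ) (k : ℕ) :
    ∃ (pt : (ω ^ (m : Ordinal.{u}) * (k : Ordinal.{u})).ToType → L)
      (tr : (ω ^ (m : Ordinal.{u}) * (k : Ordinal.{u})).ToType → Fin k),
      IsTracking (φ '' Set.Iio (ω ^ (m : Ordinal.{u}))) rk pt tr := by
  set δ : Ordinal.{u} := ω ^ (m : Ordinal.{u}) * (k : Ordinal.{u}) with hδ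
  let v : δ.ToType → Ordinal.{u} := fun x => typein (fun a b : δ.ToType => a < b) x
  have hv : ∀ x, ∃ (i : ℕ) (a : Ordinal.{u}), i < k ∧ a < ω ^ (m : Ordinal.{u}) ∧
      v x = ω ^ (m : Ordinal.{u}) * i + a := fun x => lt_omega0_opow_mul_nat (typein_lt_self x)
  choose i a hi ha hia using hv
  have hblock : ∀ (j j' : ℕ) (b b' : Ordinal.{u}), b < ω ^ (m : Ordinal.{u}) → j < j' →
      ω ^ (m : Ordinal.{u}) * (j : Ordinal.{u}) + b < ω ^ (m : Ordinal.{u}) * j' + b' := by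
    intro j j' b b' hb hj
    calc ω ^ (m : Ordinal.{u}) * (j : Ordinal.{u}) + b
        < ω ^ (m : Ordinal.{u}) * (j : Ordinal.{u}) + ω ^ (m : Ordinal.{u}) :=
          (add_lt_add_iff_left _).2 hb
      _ = ω ^ (m : Ordinal.{u}) * ((j + 1 : ℕ) : Ordinal.{u}) := by
          rw [Nat.cast_add_one, mul_add, mul_one]
      _ ≤ ω ^ (m : Ordinal.{u}) * (j' : Ordinal.{u}) := by
          gcongr
          omega
      _ ≤ _ := le_self_add
  have huniq : ∀ (j j' : ℕ) (b b' : Ordinal.{u}), b < ω ^ (m : Ordinal.{u}) →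
      b' < ω ^ (m : Ordinal.{u}) →
      ω ^ (m : Ordinal.{u}) * (j : Ordinal.{u}) + b = ω ^ (m : Ordinal.{u}) * j' + b' →
      j = j' ∧ b = b' := by
    intro j j' b b' hb hb' he
    rcases lt_trichotomy j j' with hj | rfl | hj
    · exact absurd he (hblock j j' b b' hb hj).ne
    · exact ⟨rfl, add_left_cancel he⟩
    · exact absurd he (hblock j' j b' b hb' hj).ne'
  have hφ : ∀ b b', b < ω ^ (m : Ordinal.{u}) → b' < ω ^ (m : Ordinal.{u}) → φ b = φ b' →
      b = b' := by
    intro b b' hb hb' he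
    rcases lt_trichotomy b b' with hlt | rfl | hlt
    · have := h.rank b b' hlt hb'
      rw [he] at this
      exact absurd this (rankLT_asymm this)
    · rfl
    · have := h.rank b' b hlt hb
      rw [he] at this
      exact absurd this (rankLT_asymm this)
  have hlt : ∀ x y, x < y → (⟨i x, hi x⟩ : Fin k) < ⟨i y, hi y⟩ ∨
      ((⟨i x, hi x⟩ : Fin k) = ⟨i y, hi y⟩ ∧ rankLT rk (φ (a x)) (φ (a y))) := by
    intro x y hxy
    have hvxy : v x < v y := (typein_lt_typein _).2 hxy
    rw [hia, hia] at hvxy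
    rcases lt_trichotomy (i x) (i y) with hj | hj | hj
    · exact Or.inl hj
    · refine Or.inr ⟨Fin.ext hj, h.rank _ _ ?_ (ha y)⟩
      rw [hj] at hvxy
      exact (add_lt_add_iff_left _).1 hvxy
    · exact absurd hvxy (lt_asymm (hblock _ _ _ _ (ha y) hj))
  refine ⟨fun x => φ (a x), fun x => ⟨i x, hi x⟩, ⟨fun x => ⟨a x, ha x, rfl⟩, ?_, ?_, ?_⟩⟩
  · rintro j _ ⟨b, hb, rfl⟩
    have hlt' : ω ^ (m : Ordinal.{u}) * ((j : ℕ) : Ordinal.{u}) + b < typeLT δ.ToType := by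
      rw [type_toType, hδ]
      simpa using hblock j k b 0 hb j.2
    obtain ⟨x, hx⟩ := typein_surj (fun a b : δ.ToType => a < b) hlt'
    obtain ⟨h1, h2⟩ := huniq _ _ _ _ (ha x) hb ((hia x).symm.trans hx)
    exact ⟨x, Fin.ext h1, by rw [h2]⟩
  · intro x y h1 h2
    have h3 := hφ _ _ (ha x) (ha y) h2
    refine typein_injective (fun a b : δ.ToType => a < b) ?_
    change v x = v y
    rw [hia, hia, h3, Fin.mk.inj h1]
  · intro x y
    refine ⟨hlt x y, fun hxy => ?_⟩
    rcases lt_trichotomy x y with h1 | rfl | h1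
    · exact h1
    · rcases hxy with h2 | h2
      · exact absurd h2 (lt_irrefl _)
      · exact absurd h2.2 (rankLT_asymm h2.2)
    · rcases hlt y x h1 with h3 | h3 <;> rcases hxy with h2 | h2
      · exact absurd h2 (lt_asymm h3)
      · exact absurd h3 (h2.1 ▸ lt_irrefl _)
      · exact absurd h2 (h3.1 ▸ lt_irrefl _)
      · exact absurd h2.2 (rankLT_asymm h3.2)

/-- The lower bound: an order that contains a comb of height `m`. -/
theorem HasComb.isFiniteWordOracleAutomaticOrdinal {m : ℕ} (h : HasComb m (Set.univ : Set L))
    {β : Ordinal.{u}} (hβ : β < ω ^ (ω ^ (m : Ordinal.{u}))) :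
    IsFiniteWordOracleAutomaticOrdinal L β := by
  obtain ⟨rk, φ, hc⟩ := exists_isRankedComb m le_rfl Set.univ Set.ordConnected_univ h
  obtain ⟨k, hk⟩ := exists_lt_two_opow_mul hβ
  obtain ⟨pt, tr, ht⟩ := hc.exists_isTracking k
  obtain ⟨E, t, hE, hEt⟩ := exists_colex_initialSegment hk
  refine ht.isFiniteWordOracleAutomaticOrdinal ?_ hE hEt
  rintro _ ⟨a, ha, rfl⟩
  exact hc.tame a ha

theorem hasComb_univ [Nonempty L] {m : ℕ}
    (h : ∀ j < m, ¬ Finite (Quotient (condSetoid L (j : Ordinal.{u})))) :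
    HasComb m (Set.univ : Set L) := by
  cases m with
  | zero => exact Set.univ_nonempty
  | succ k =>
    refine hasComb_of_infinite k _ Set.ordConnected_univ fun hfin => h k (Nat.lt_succ_self k) ?_
    have := hfin.to_subtype
    refine Finite.of_injective (β := condClass (k : Ordinal.{u}) '' (Set.univ : Set L))
      (Quotient.lift (s := condSetoid L (k : Ordinal.{u}))
        (fun x => ⟨condClass (k : Ordinal.{u}) x, ⟨x, trivial, rfl⟩⟩)
        fun x y hxy => Subtype.ext (condClass_eq_iff.2 hxy)) ?_
    intro a b
    induction a, b using Quotient.inductionOn₂ with | _ x y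
    intro hxy
    exact Quotient.sound (condClass_eq_iff.1 (congrArg Subtype.val hxy))

end trackWord

theorem mainTheorem5 {L : Type u} [LinearOrder L] [Nonempty L]
    (hscattered : IsScattered L) (hrank : FC L < ω) :
    (∀ β : Ordinal.{u},
      IsFiniteWordOracleAutomaticOrdinal L β ↔ β < ω ^ (ω ^ FCStar L)) ∧
    (∀ n : ℕ, FC L = 1 + (n : Ordinal.{u}) → FCStar L = 1 + (n : Ordinal.{u}) →
      IsFiniteWordOracleAutomaticOrdinal L (ω ^ (ω ^ (n : Ordinal.{u}))) ∧
      ∀ β : Ordinal.{u},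
        IsFiniteWordOracleAutomaticOrdinal L β ↔
          β < ω ^ (ω ^ ((n : Ordinal.{u}) + 1))) := by
  -- Scatteredness makes the infimum an attained minimum, which also bounds `FCStar L` by a finite
  -- ordinal.
  have hFC : Nat.card (Quotient (condSetoid L (FC L))) = 1 :=
    csInf_mem (s := {α | Nat.card (Quotient (condSetoid L α)) = 1})
      (exists_condensation_of_isScattered L hscattered)
  have hfin : Finite (Quotient (condSetoid L (FC L))) :=
    Nat.finite_of_card_ne_zero (by rw [hFC]; exact one_ne_zero)
  have hle : FCStar L ≤ FC L := csInf_le' hfin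
  obtain ⟨m, hm⟩ := lt_omega0.1 (hle.trans_lt hrank)
  have hstar : Finite (Quotient (condSetoid L (FCStar L))) :=
    csInf_mem (s := {α | Finite (Quotient (condSetoid L α))}) ⟨_, hfin⟩
  have hmain : ∀ β : Ordinal.{u},
      IsFiniteWordOracleAutomaticOrdinal L β ↔ β < ω ^ (ω ^ FCStar L) := by
    intro β
    rw [hm]
    refine ⟨fun h => h.lt (hm ▸ hstar), fun h => ?_⟩
    -- Minimality of `FCStar L` makes every earlier quotient infinite, as the comb requires.
    refine (hasComb_univ fun j hj hj' => ?_).isFiniteWordOracleAutomaticOrdinal h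
    have : FCStar L ≤ (j : Ordinal.{u}) := csInf_le' hj'
    rw [hm] at this
    exact absurd hj (not_lt.2 (by exact_mod_cast this))
  refine ⟨hmain, fun n _ hn => ?_⟩
  have hn' : FCStar L = (n : Ordinal.{u}) + 1 := by
    rw [hn]
    exact_mod_cast congrArg (Nat.cast (R := Ordinal.{u})) (add_comm 1 n)
  rw [hn'] at hmain
  refine ⟨(hmain _).2 ?_, hmain⟩
  rw [opow_lt_opow_iff_right one_lt_omega0, opow_lt_opow_iff_right one_lt_omega0]
  exact Order.lt_add_one_iff.2 le_rfl
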